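/- Let $\tilde{\mathcal A}=\{\sum_{\nu\ge 0}P_\nu(a)\,b^\nu : P_\nu\in\mathbb C[z]\}$ be the $\mathbb C$-algebra with $ab-ba=b^2$ in which left and right multiplication by $a$ are continuous for the $b$-adic topology; it contains $\mathbb C[[b]]$, and it embeds in the localisation $\tilde{\mathcal A}[b^{-1}]$. An element is homogeneous of degree $k$ in $(a,b)$ if it has the form $\sum_{j=0}^k\lambda_j a^jb^{k-j}$ with $\lambda_j\in\mathbb C$, and it is then monic in $a$ if $\lambda_k=1$. The $(a,b)$-valuation of an element $x$ is the least degree $n+j$ of a monomial $b^na^j$ occurring in $x$ (and $+\infty$ if $x=0$). An $(a,b)$-module is a left $\tilde{\mathcal A}$-module $E$ that is free of finite type over $\mathbb C[[b]]$; its rank is its rank over $\mathbb C[[b]]$. Its saturation $E^\sharp$ is the smallest $\mathbb C[[b]]$-submodule of $E[b^{-1}]$ that contains $E$ and is stable under $b^{-1}a$. $E$ is regular if $E^\sharp$ is of finite type over $\mathbb C[[b]]$, and then its Bernstein polynomial $B_E\in\mathbb C[x]$ is the characteristic polynomial of $-b^{-1}a$ acting on the finite-dimensional complex vector space $E^\sharp/bE^\sharp$.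 **Theorem.** Let $I$ be a left ideal of $\tilde{\mathcal A}$ and let $k\ge 0$ be an integer. Then $E:=\tilde{\mathcal A}/I$ is a regular $(a,b)$-module of rank $k$ if and only if $I$ is principal and has a generator of the form $$x=P+b^2R,$$ where $P\in\tilde{\mathcal A}$ is homogeneous of degree $k$ in $(a,b)$ and monic in $a$, and $R\in\tilde{\mathcal A}$ is a polynomial in $a$ of degree at most $k-1$, with coefficients in $\mathbb C[[b]]$, whose $(a,b)$-valuation is at least $k-1$ (for $k=0$ this means $P=1$, $R=0$). In that case $P$ and $R$, and so the generator $P+b^2R$ of this form, are uniquely determined by $I$. Moreover $B_E$ is also the minimal polynomial of $-b^{-1}a$ acting on $E^\sharp/bE^\sharp$, and in $\tilde{\mathcal A}[b^{-1}]$ $$(-b)^k\,B_E(-b^{-1}a)=P .$$ Hence $P$ depends only on the isomorphism class of the left $\tilde{\mathcal A}$-module $E$: if $I'$ is another left ideal generated by an element $P'+b^2R'$ of this form (for some degree $k'$) and $\tilde{\mathcal A}/I\simeq\tilde{\mathcal A}/I'$ as left $\tilde{\mathcal A}$-modules, then $P=P'$. -/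

import Mathlib

open scoped Polynomial PowerSeries

noncomputable section

namespace AB

/-! ### The algebra `Ã` -/

/-- The coefficientwise `i`-th divided derivative `(1 / i!) ∂_a ^ i` on `ℂ[a]⟦b⟧`. -/
def divDer (i : ℕ) : ℂ[X]⟦X⟧ →ₗ[ℂ] ℂ[X]⟦X⟧ where
  toFun f := PowerSeries.mk fun n => Polynomial.hasseDeriv i (PowerSeries.coeff n f)
  map_add' f g := by ext n; simp
  map_smul' c f := by
    ext1 n
    have h : ∀ g : ℂ[X]⟦X⟧, PowerSeries.coeff n (c • g) = c • PowerSeries.coeff n g :=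
      fun _ => rfl
    simp only [h, PowerSeries.coeff_mk, RingHom.id_apply]
    ext k
    simp [Polynomial.hasseDeriv_coeff]

/-- The derivation `b ^ 2 ∂_b` on `ℂ[a]⟦b⟧`. -/
def bsqDer : Module.End ℂ ℂ[X]⟦X⟧ where
  toFun f := PowerSeries.X ^ 2 * PowerSeries.derivative ℂ[X] f
  map_add' f g := by simp [mul_add]
  map_smul' c f := by
    have h : ∀ (n : ℕ) (g : ℂ[X]⟦X⟧),
        PowerSeries.coeff n (c • g) = c • PowerSeries.coeff n g := fun _ _ => rfl
    ext1 n
    rw [RingHom.id_apply, h, PowerSeries.coeff_X_pow_mul', PowerSeries.coeff_X_pow_mul']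
    split_ifs
    · rw [PowerSeries.coeff_derivative, PowerSeries.coeff_derivative, h, smul_mul_assoc]
    · simp

/-- The product of `Ã` in normally ordered form: the family `f = ∑ bⁿ Yₙ(a)` is encoded by the
power series in `b` with coefficients `Yₙ ∈ ℂ[a]`, and as `[a, S(b)] = b² S'(b)`, one has
`f ⋆ g = ∑ᵢ (1 / i!) (∂_a ^ i f) ((b² ∂_b) ^ i g)`.  The `i`-th term is divisible by `bⁱ`, so that
the terms with `i ≤ N` give the coefficient of `b ^ N`. -/
def starMul (f g : ℂ[X]⟦X⟧) : ℂ[X]⟦X⟧ :=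
  PowerSeries.mk fun N =>
    ∑ i ∈ Finset.range (N + 1), PowerSeries.coeff N (divDer i f * (bsqDer ^ i) g)

theorem coeff_divDer (i n : ℕ) (f : ℂ[X]⟦X⟧) :
    PowerSeries.coeff n (divDer i f) = Polynomial.hasseDeriv i (PowerSeries.coeff n f) := by
  simp [divDer]

theorem coeff_bsqDer (n : ℕ) (f : ℂ[X]⟦X⟧) :
    PowerSeries.coeff n (bsqDer f) = ((n - 1 : ℕ) : ℂ[X]) * PowerSeries.coeff (n - 1) f := by
  change PowerSeries.coeff n (PowerSeries.X ^ 2 * PowerSeries.derivative ℂ[X] f) = _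
  rw [PowerSeries.coeff_X_pow_mul']
  match n with
  | 0 => simp
  | 1 => simp
  | n + 2 => simp [PowerSeries.coeff_derivative]; ring

theorem derivative_mul' {R : Type*} [CommRing R] (f g : R⟦X⟧) :
    PowerSeries.derivative R (f * g) =
      f * PowerSeries.derivative R g + g * PowerSeries.derivative R f := by
  rw [Derivation.leibniz, smul_eq_mul, smul_eq_mul]

theorem bsqDer_mul (f g : ℂ[X]⟦X⟧) : bsqDer (f * g) = bsqDer f * g + f * bsqDer g := by
  change PowerSeries.X ^ 2 * PowerSeries.derivative ℂ[X] (f * g) =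
    (PowerSeries.X ^ 2 * PowerSeries.derivative ℂ[X] f) * g +
      f * (PowerSeries.X ^ 2 * PowerSeries.derivative ℂ[X] g)
  rw [derivative_mul']
  ring

theorem divDer_zero (f : ℂ[X]⟦X⟧) : divDer 0 f = f := by
  ext1 n; rw [coeff_divDer, Polynomial.hasseDeriv_zero']

theorem divDer_mul (k : ℕ) (f g : ℂ[X]⟦X⟧) :
    divDer k (f * g) = ∑ p ∈ Finset.HasAntidiagonal.antidiagonal k, divDer p.1 f * divDer p.2 g := by
  ext1 n
  rw [coeff_divDer, PowerSeries.coeff_mul, map_sum, map_sum]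
  simp_rw [Polynomial.hasseDeriv_mul, PowerSeries.coeff_mul, coeff_divDer]
  rw [Finset.sum_comm]

theorem divDer_divDer (k l : ℕ) (f : ℂ[X]⟦X⟧) :
    divDer k (divDer l f) = (k + l).choose k • divDer (k + l) f := by
  ext1 n
  rw [coeff_divDer, coeff_divDer, map_nsmul, coeff_divDer]
  exact congrArg (fun φ : ℂ[X] →ₗ[ℂ] ℂ[X] => φ (PowerSeries.coeff n f))
    (Polynomial.hasseDeriv_comp k l)

theorem divDer_bsqDer (k : ℕ) (f : ℂ[X]⟦X⟧) : divDer k (bsqDer f) = bsqDer (divDer k f) := by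
  ext1 n
  rw [coeff_divDer, coeff_bsqDer, coeff_bsqDer, coeff_divDer, ← nsmul_eq_mul, map_nsmul,
    nsmul_eq_mul]

theorem divDer_bsqDer_pow (k i : ℕ) (f : ℂ[X]⟦X⟧) :
    divDer k ((bsqDer ^ i) f) = (bsqDer ^ i) (divDer k f) := by
  induction i with
  | zero => rfl
  | succ i ih => rw [pow_succ', Module.End.mul_apply, divDer_bsqDer, ih, Module.End.mul_apply]

theorem bsqDer_pow_mul (k : ℕ) (f g : ℂ[X]⟦X⟧) :
    (bsqDer ^ k) (f * g) = ∑ p ∈ Finset.HasAntidiagonal.antidiagonal k,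
      k.choose p.1 • ((bsqDer ^ p.1) f * (bsqDer ^ p.2) g) := by
  induction k with
  | zero => simp
  | succ k ih =>
    rw [Finset.sum_antidiagonal_choose_succ_nsmul
      (fun i j => (bsqDer ^ i) f * (bsqDer ^ j) g) k, pow_succ', Module.End.mul_apply, ih, map_sum,
      ← Finset.sum_add_distrib]
    refine Finset.sum_congr rfl fun p hp => ?_
    have hs : k.choose p.2 = k.choose p.1 :=
      (Nat.choose_symm_of_eq_add (Finset.HasAntidiagonal.mem_antidiagonal.1 hp).symm).symm
    rw [map_nsmul, bsqDer_mul, hs, ← nsmul_add, pow_succ', pow_succ', Module.End.mul_apply,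
      Module.End.mul_apply, add_comm]

theorem dvd_divDer {M : ℕ} {f : ℂ[X]⟦X⟧} (i : ℕ) (h : (PowerSeries.X : ℂ[X]⟦X⟧) ^ M ∣ f) :
    (PowerSeries.X : ℂ[X]⟦X⟧) ^ M ∣ divDer i f := by
  rw [PowerSeries.X_pow_dvd_iff] at h ⊢
  intro m hm
  rw [coeff_divDer, h m hm, map_zero]

theorem dvd_bsqDer {M : ℕ} {f : ℂ[X]⟦X⟧} (h : (PowerSeries.X : ℂ[X]⟦X⟧) ^ M ∣ f) :
    (PowerSeries.X : ℂ[X]⟦X⟧) ^ (M + 1) ∣ bsqDer f := by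
  rw [PowerSeries.X_pow_dvd_iff] at h ⊢
  intro m hm
  rw [coeff_bsqDer]
  rcases Nat.eq_zero_or_pos m with rfl | h0
  · simp
  · rw [h (m - 1) (by omega), mul_zero]

theorem dvd_bsqDer_pow {M : ℕ} {f : ℂ[X]⟦X⟧} (i : ℕ) (h : (PowerSeries.X : ℂ[X]⟦X⟧) ^ M ∣ f) :
    (PowerSeries.X : ℂ[X]⟦X⟧) ^ (M + i) ∣ (bsqDer ^ i) f := by
  induction i with
  | zero => simpa using h
  | succ i ih => rw [pow_succ', Module.End.mul_apply]; exact dvd_bsqDer ih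

theorem dvd_bsqDer_pow' (i : ℕ) (f : ℂ[X]⟦X⟧) :
    (PowerSeries.X : ℂ[X]⟦X⟧) ^ i ∣ (bsqDer ^ i) f := by
  simpa using dvd_bsqDer_pow (M := 0) (f := f) i (by simp)

/-- `f ⋆ g` modulo `b ^ M` only involves the terms with `i < M`. -/
theorem dvd_star_sub (M : ℕ) (f g : ℂ[X]⟦X⟧) :
    (PowerSeries.X : ℂ[X]⟦X⟧) ^ M ∣
      starMul f g - ∑ i ∈ Finset.range M, divDer i f * (bsqDer ^ i) g := by
  rw [PowerSeries.X_pow_dvd_iff]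
  intro m hm
  rw [map_sub, starMul, PowerSeries.coeff_mk, map_sum, sub_eq_zero]
  refine Finset.sum_subset (by intro x; simp; omega) fun i _ hi => ?_
  have : (PowerSeries.X : ℂ[X]⟦X⟧) ^ i ∣ divDer i f * (bsqDer ^ i) g :=
    (dvd_bsqDer_pow' i g).mul_left _
  exact PowerSeries.X_pow_dvd_iff.1 this m (by simpa using hi)

theorem eq_of_dvd {f g : ℂ[X]⟦X⟧} (h : ∀ M : ℕ, (PowerSeries.X : ℂ[X]⟦X⟧) ^ M ∣ f - g) :
    f = g := by
  ext1 n
  have := PowerSeries.X_pow_dvd_iff.1 (h (n + 1)) n (Nat.lt_succ_self n)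
  rwa [map_sub, sub_eq_zero] at this

theorem star_add (f g h : ℂ[X]⟦X⟧) : starMul f (g + h) = starMul f g + starMul f h := by
  ext1 n
  simp [starMul, mul_add, Finset.sum_add_distrib]

theorem add_star (f g h : ℂ[X]⟦X⟧) : starMul (f + g) h = starMul f h + starMul g h := by
  ext1 n
  simp [starMul, add_mul, Finset.sum_add_distrib]

/-- The sum over triples to which both bracketings of a triple product reduce. -/
theorem dvd_triple (M : ℕ) (T : ℕ → ℕ → ℕ → ℂ[X]⟦X⟧)
    (hT : ∀ p j q, (PowerSeries.X : ℂ[X]⟦X⟧) ^ (p + j + q) ∣ T p j q) :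
    (PowerSeries.X : ℂ[X]⟦X⟧) ^ M ∣
      (∑ i ∈ Finset.range M, ∑ j ∈ Finset.range M, ∑ p ∈ Finset.HasAntidiagonal.antidiagonal i, T p.1 j p.2) -
      ∑ p ∈ Finset.range M, ∑ j ∈ Finset.range M, ∑ q ∈ Finset.range M, T p j q := by
  have e1 : ∀ j, ∑ i ∈ Finset.range M, ∑ p ∈ Finset.HasAntidiagonal.antidiagonal i, T p.1 j p.2 =
      ∑ p ∈ Finset.range M, ∑ q ∈ Finset.range M, if p + q < M then T p j q else 0 := by
    intro j
    rw [Finset.sum_sigma', ← Finset.sum_product', ← Finset.sum_filter]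
    refine Finset.sum_bij' (fun x _ => x.2) (fun x _ => ⟨x.1 + x.2, x⟩) ?_ ?_ ?_ ?_ ?_
    · rintro ⟨i, p, q⟩ h
      simp at h ⊢; omega
    · rintro ⟨p, q⟩ h
      simp at h ⊢; omega
    · rintro ⟨i, p, q⟩ h
      simp at h
      obtain ⟨_, rfl⟩ := h
      rfl
    · rintro ⟨p, q⟩ h; rfl
    · rintro ⟨i, p, q⟩ h; rfl
  rw [Finset.sum_comm]
  simp_rw [e1]
  rw [Finset.sum_comm, ← Finset.sum_sub_distrib]
  refine Finset.dvd_sum fun p _ => ?_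
  rw [← Finset.sum_sub_distrib]
  refine Finset.dvd_sum fun j _ => ?_
  rw [← Finset.sum_sub_distrib]
  refine Finset.dvd_sum fun q _ => ?_
  split_ifs with h
  · simp
  · rw [zero_sub, dvd_neg]
    exact (pow_dvd_pow _ (by omega)).trans (hT p j q)

theorem star_assoc (f g h : ℂ[X]⟦X⟧) : starMul (starMul f g) h = starMul f (starMul g h) := by
  refine eq_of_dvd fun M => ?_
  set T : ℕ → ℕ → ℕ → ℂ[X]⟦X⟧ := fun p j q =>
    (p + j).choose p • (divDer (p + j) f * ((bsqDer ^ j) (divDer q g) * (bsqDer ^ (p + q)) h))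
    with hTdef
  have hT : ∀ p j q, (PowerSeries.X : ℂ[X]⟦X⟧) ^ (p + j + q) ∣ T p j q := by
    intro p j q
    rw [hTdef]
    refine dvd_smul_of_dvd _ ?_
    refine Dvd.dvd.mul_left ?_ _
    rw [show p + j + q = j + (p + q) by ring, pow_add]
    exact mul_dvd_mul (dvd_bsqDer_pow' _ _) (dvd_bsqDer_pow' _ _)
  have hT' : ∀ p j q, (PowerSeries.X : ℂ[X]⟦X⟧) ^ (p + j + q) ∣ T q p j := by
    intro p j q
    rw [show p + j + q = q + p + j by ring]
    exact hT q p j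
  -- left bracketing
  have hL : (PowerSeries.X : ℂ[X]⟦X⟧) ^ M ∣ starMul (starMul f g) h -
      ∑ i ∈ Finset.range M, ∑ j ∈ Finset.range M, ∑ p ∈ Finset.HasAntidiagonal.antidiagonal i, T p.1 j p.2 := by
    have h1 := dvd_star_sub M (starMul f g) h
    have h2 : (PowerSeries.X : ℂ[X]⟦X⟧) ^ M ∣
        (∑ i ∈ Finset.range M, divDer i (starMul f g) * (bsqDer ^ i) h) -
        ∑ i ∈ Finset.range M, ∑ j ∈ Finset.range M, ∑ p ∈ Finset.HasAntidiagonal.antidiagonal i, T p.1 j p.2 := by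
      rw [← Finset.sum_sub_distrib]
      refine Finset.dvd_sum fun i _ => ?_
      have h3 := (dvd_divDer i (dvd_star_sub M f g)).mul_right ((bsqDer ^ i) h)
      convert h3 using 1
      rw [map_sub, sub_mul, map_sum, Finset.sum_mul]
      congr 1
      refine Finset.sum_congr rfl fun j _ => ?_
      rw [divDer_mul, Finset.sum_mul]
      refine Finset.sum_congr rfl fun p hp => ?_
      rw [divDer_divDer, divDer_bsqDer_pow, hTdef]
      simp only [Finset.HasAntidiagonal.mem_antidiagonal.1 hp, smul_mul_assoc, mul_assoc]
    simpa using dvd_add h1 h2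
  -- right bracketing
  have hR : (PowerSeries.X : ℂ[X]⟦X⟧) ^ M ∣ starMul f (starMul g h) -
      ∑ i ∈ Finset.range M, ∑ j ∈ Finset.range M, ∑ p ∈ Finset.HasAntidiagonal.antidiagonal i, T p.2 p.1 j := by
    have h1 := dvd_star_sub M f (starMul g h)
    have h2 : (PowerSeries.X : ℂ[X]⟦X⟧) ^ M ∣
        (∑ i ∈ Finset.range M, divDer i f * (bsqDer ^ i) (starMul g h)) -
        ∑ i ∈ Finset.range M, ∑ j ∈ Finset.range M,
          ∑ p ∈ Finset.HasAntidiagonal.antidiagonal i, T p.2 p.1 j := by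
      rw [← Finset.sum_sub_distrib]
      refine Finset.dvd_sum fun i _ => ?_
      have h3 := ((pow_dvd_pow _ (Nat.le_add_right M i)).trans
        (dvd_bsqDer_pow i (dvd_star_sub M g h))).mul_left (divDer i f)
      convert h3 using 1
      rw [map_sub, mul_sub, map_sum, Finset.mul_sum]
      congr 1
      refine Finset.sum_congr rfl fun j _ => ?_
      rw [bsqDer_pow_mul, Finset.mul_sum]
      refine Finset.sum_congr rfl fun p hp => ?_
      have hp' := Finset.HasAntidiagonal.mem_antidiagonal.1 hp
      have hpow : (bsqDer ^ p.2) ((bsqDer ^ j) h) = (bsqDer ^ (p.2 + j)) h := by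
        rw [pow_add, Module.End.mul_apply]
      have hc : i.choose p.2 = i.choose p.1 := (Nat.choose_symm_of_eq_add hp'.symm).symm
      rw [hTdef, hpow, mul_smul_comm, ← hc]
      simp only [show p.2 + p.1 = i by omega]
    simpa using dvd_add h1 h2
  have hL' := dvd_triple M T hT
  have hR' := dvd_triple M (fun p j q => T q p j) hT'
  have e : ∑ p ∈ Finset.range M, ∑ j ∈ Finset.range M, ∑ q ∈ Finset.range M, T q p j =
      ∑ p ∈ Finset.range M, ∑ j ∈ Finset.range M, ∑ q ∈ Finset.range M, T p j q := by
    rw [Finset.sum_congr rfl fun p _ => Finset.sum_comm, Finset.sum_comm]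
  rw [← e] at hL'
  have := dvd_sub (dvd_add hL hL') (dvd_add hR hR')
  convert this using 1
  ring

theorem star_eq_mul_of_divDer {f : ℂ[X]⟦X⟧} (hf : ∀ i, divDer (i + 1) f = 0) (g : ℂ[X]⟦X⟧) :
    starMul f g = f * g := by
  ext1 n
  rw [starMul, PowerSeries.coeff_mk, Finset.sum_range_succ', Finset.sum_eq_zero fun i _ => by
    rw [hf, zero_mul, map_zero], zero_add, divDer_zero, pow_zero, Module.End.one_apply]

theorem star_eq_mul_of_bsqDer (f : ℂ[X]⟦X⟧) {g : ℂ[X]⟦X⟧} (hg : bsqDer g = 0) :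
    starMul f g = f * g := by
  ext1 n
  rw [starMul, PowerSeries.coeff_mk, Finset.sum_range_succ', Finset.sum_eq_zero fun i _ => by
    rw [pow_succ, Module.End.mul_apply, hg, map_zero, mul_zero, map_zero], zero_add, divDer_zero,
    pow_zero, Module.End.one_apply]

theorem divDer_map_C (i : ℕ) (S : ℂ⟦X⟧) :
    divDer (i + 1) (PowerSeries.map Polynomial.C S) = 0 := by
  ext1 n
  rw [coeff_divDer, PowerSeries.coeff_map, Polynomial.hasseDeriv_C _ _ (Nat.succ_pos i), map_zero]

theorem bsqDer_C (Y : ℂ[X]) : bsqDer (PowerSeries.C Y) = 0 := by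
  ext1 n
  rw [coeff_bsqDer, PowerSeries.coeff_C, map_zero]
  split_ifs with h
  · rw [h]; simp
  · simp

theorem map_C_X : PowerSeries.map Polynomial.C (PowerSeries.X : ℂ⟦X⟧) = PowerSeries.X := by simp

theorem smul_eq_map_C_mul (c : ℂ) (f : ℂ[X]⟦X⟧) :
    c • f = PowerSeries.map Polynomial.C (PowerSeries.C c) * f := by
  have h : ∀ n, PowerSeries.coeff n (c • f) = c • PowerSeries.coeff n f := fun _ => rfl
  ext1 n
  rw [h, PowerSeries.map_C, PowerSeries.coeff_C_mul, Polynomial.smul_eq_C_mul]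

/-- The algebra `Ã = {∑ bⁿ Yₙ(a) : Yₙ ∈ ℂ[a]}` with `a b - b a = b²`.  An element is encoded by
the family `(Yₙ)`, that is, by a power series in `b` with coefficients in `ℂ[a]`. -/
@[ext]
structure ATilde : Type where
  /-- The power series `∑ Yₙ bⁿ`. -/
  series : ℂ[X]⟦X⟧

namespace ATilde

instance : Zero ATilde := ⟨⟨0⟩⟩
instance : One ATilde := ⟨⟨1⟩⟩
instance : Add ATilde := ⟨fun x y => ⟨x.series + y.series⟩⟩
instance : Neg ATilde := ⟨fun x => ⟨-x.series⟩⟩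
instance : Sub ATilde := ⟨fun x y => ⟨x.series - y.series⟩⟩
instance : Mul ATilde := ⟨fun x y => ⟨starMul x.series y.series⟩⟩
instance : SMul ℕ ATilde := ⟨fun n x => ⟨n • x.series⟩⟩
instance : SMul ℤ ATilde := ⟨fun n x => ⟨n • x.series⟩⟩
instance : SMul ℂ ATilde := ⟨fun c x => ⟨c • x.series⟩⟩

theorem series_injective : Function.Injective series := fun _ _ => ATilde.ext

@[simp] theorem series_zero : (0 : ATilde).series = 0 := rfl
@[simp] theorem series_one : (1 : ATilde).series = 1 := rfl
@[simp] theorem series_add (x y : ATilde) : (x + y).series = x.series + y.series := rfl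
@[simp] theorem series_neg (x : ATilde) : (-x).series = -x.series := rfl
@[simp] theorem series_sub (x y : ATilde) : (x - y).series = x.series - y.series := rfl
@[simp] theorem series_smul (c : ℂ) (x : ATilde) : (c • x).series = c • x.series := rfl
theorem series_mul (x y : ATilde) : (x * y).series = starMul x.series y.series := rfl

instance : AddCommGroup ATilde :=
  series_injective.addCommGroup series rfl (fun _ _ => rfl) (fun _ => rfl) (fun _ _ => rfl)
    (fun _ _ => rfl) (fun _ _ => rfl)

instance : Ring ATilde where
  __ := (inferInstance : AddCommGroup ATilde)
  left_distrib x y z := ATilde.ext (star_add x.series y.series z.series)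
  right_distrib x y z := ATilde.ext (add_star x.series y.series z.series)
  zero_mul x := by
    have h := add_star 0 0 x.series
    rw [add_zero] at h
    exact ATilde.ext (left_eq_add.1 h)
  mul_zero x := by
    have h := star_add x.series 0 0
    rw [add_zero] at h
    exact ATilde.ext (left_eq_add.1 h)
  mul_assoc x y z := ATilde.ext (star_assoc x.series y.series z.series)
  one_mul x := by
    have h := star_eq_mul_of_divDer (fun i => divDer_map_C i 1) x.series
    rw [map_one, one_mul] at h
    exact ATilde.ext h
  mul_one x := by
    have h := star_eq_mul_of_bsqDer x.series (bsqDer_C 1)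
    rw [map_one, mul_one] at h
    exact ATilde.ext h

/-- The embedding of `ℂ⟦b⟧` in `Ã`. -/
def ofB : ℂ⟦X⟧ →+* ATilde where
  toFun S := ⟨PowerSeries.map Polynomial.C S⟩
  map_one' := ATilde.ext (map_one _)
  map_mul' S T := ATilde.ext <| (map_mul _ S T).trans
    (star_eq_mul_of_divDer (fun i => divDer_map_C i S) _).symm
  map_zero' := ATilde.ext (map_zero _)
  map_add' S T := ATilde.ext (map_add _ S T)

theorem series_ofB (S : ℂ⟦X⟧) : (ofB S).series = PowerSeries.map Polynomial.C S := rfl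

theorem series_ofB_mul (S : ℂ⟦X⟧) (x : ATilde) :
    (ofB S * x).series = PowerSeries.map Polynomial.C S * x.series :=
  star_eq_mul_of_divDer (fun i => divDer_map_C i S) _

/-- The embedding of `ℂ` in `Ã`, with central image. -/
instance : Algebra ℂ ATilde where
  algebraMap := ofB.comp PowerSeries.C
  commutes' c x := by
    refine ATilde.ext ((series_ofB_mul _ x).trans ?_)
    rw [RingHom.comp_apply, series_mul, series_ofB, PowerSeries.map_C,
      star_eq_mul_of_bsqDer _ (bsqDer_C _), mul_comm]
  smul_def' c x := ATilde.ext <|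
    (smul_eq_map_C_mul c x.series).trans (series_ofB_mul _ x).symm

/-- The element `a`. -/
def a : ATilde := ⟨PowerSeries.C Polynomial.X⟩

/-- The element `b`. -/
def b : ATilde := ofB PowerSeries.X

theorem series_b : b.series = PowerSeries.X := map_C_X

theorem series_b_mul (x : ATilde) : (b * x).series = PowerSeries.X * x.series := by
  rw [b, series_ofB_mul, map_C_X]

theorem series_mul_C (x : ATilde) (Y : ℂ[X]) :
    (x * ⟨PowerSeries.C Y⟩ : ATilde).series = x.series * PowerSeries.C Y :=
  star_eq_mul_of_bsqDer _ (bsqDer_C Y)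

theorem a_pow (j : ℕ) : a ^ j = ⟨PowerSeries.C (Polynomial.X ^ j)⟩ := by
  induction j with
  | zero => exact ATilde.ext (by simp)
  | succ j ih => exact ATilde.ext (by rw [pow_succ, a, series_mul_C, ← a, ih, pow_succ, map_mul])

/-- The coefficient of `bⁿ aʲ` in an element of `Ã`. -/
def coef (x : ATilde) (n j : ℕ) : ℂ := (PowerSeries.coeff n x.series).coeff j

/-- Elements of `Ã` are expanded with the powers of `b` on the left. -/
theorem coef_ofB_mul_a_pow (S : ℂ⟦X⟧) (j n i : ℕ) :
    coef (ofB S * a ^ j) n i = if i = j then PowerSeries.coeff n S else 0 := by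
  rw [coef, series_ofB_mul, a_pow, PowerSeries.coeff_mul_C, PowerSeries.coeff_map,
    Polynomial.coeff_C_mul, Polynomial.coeff_X_pow]
  simp

theorem bsqDer_pow_succ_X (i : ℕ) :
    (bsqDer ^ i) PowerSeries.X = (i.factorial : ℂ[X]⟦X⟧) * PowerSeries.X ^ (i + 1) := by
  induction i with
  | zero => simp
  | succ i ih =>
    rw [pow_succ', Module.End.mul_apply, ih]
    ext1 n
    rw [coeff_bsqDer, ← nsmul_eq_mul (i.factorial), ← nsmul_eq_mul ((i + 1).factorial), map_nsmul,
      map_nsmul, PowerSeries.coeff_X_pow, PowerSeries.coeff_X_pow, Nat.factorial_succ]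
    by_cases h : n = i + 1 + 1
    · subst h; simp
    · rw [if_neg h]
      rcases Nat.eq_zero_or_pos n with rfl | h0
      · simp
      · rw [if_neg (by omega)]; simp

/-- The defining commutation relation of `Ã`. -/
theorem a_mul_b_sub : a * b - b * a = b ^ 2 := by
  have e : a * b = b * a + b ^ 2 := by
    refine ATilde.ext (eq_of_dvd fun M => ?_)
    have h0 : ∀ i, divDer (i + 1 + 1) a.series = 0 := by
      intro i
      ext1 n
      rw [coeff_divDer, a, PowerSeries.coeff_C, map_zero]
      split_ifs
      · exact Polynomial.hasseDeriv_X _ (by omega)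
      · simp
    have h1 : divDer 1 a.series = 1 := by
      ext1 n
      rw [coeff_divDer, a, PowerSeries.coeff_C, PowerSeries.coeff_one]
      split_ifs <;> simp
    have h := dvd_star_sub (M + 2) a.series b.series
    rw [← series_mul, Finset.sum_range_succ', Finset.sum_range_succ',
      Finset.sum_eq_zero fun i _ => by rw [h0, zero_mul]] at h
    refine (pow_dvd_pow _ (Nat.le_add_right M 2)).trans ?_
    convert h using 2
    rw [series_add, series_b_mul, pow_two, series_b_mul, zero_add, zero_add, h1,
      divDer_zero, series_b, bsqDer_pow_succ_X, bsqDer_pow_succ_X]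
    simp
    ring
  rw [e, add_sub_cancel_left]

/-! ### The localisation `Ã[b⁻¹]` -/

theorem divDer_X_mul (i : ℕ) (f : ℂ[X]⟦X⟧) :
    divDer i (PowerSeries.X * f) = PowerSeries.X * divDer i f := by
  ext1 n
  rw [coeff_divDer]
  cases n with
  | zero => simp
  | succ n => rw [PowerSeries.coeff_succ_X_mul, PowerSeries.coeff_succ_X_mul, coeff_divDer]

/-- `b x = x' b` with `x' = x - b ∂_a x`. -/
theorem b_mul_eq (x : ATilde) :
    b * x = ⟨x.series - PowerSeries.X * divDer 1 x.series⟩ * b := by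
  refine ATilde.ext (eq_of_dvd fun M => ?_)
  have h := dvd_star_sub M (x.series - PowerSeries.X * divDer 1 x.series) b.series
  have key : ∀ M : ℕ, ∑ i ∈ Finset.range M,
      divDer i (x.series - PowerSeries.X * divDer 1 x.series) * (bsqDer ^ i) b.series =
      PowerSeries.X * x.series - (M.factorial : ℂ[X]⟦X⟧) * PowerSeries.X ^ (M + 1) *
        divDer M x.series := by
    intro M
    induction M with
    | zero => simp [divDer_zero]
    | succ M ih =>
      rw [Finset.sum_range_succ, ih, series_b, bsqDer_pow_succ_X, map_sub, divDer_X_mul,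
        divDer_divDer, Nat.choose_succ_self_right, nsmul_eq_mul, Nat.factorial_succ]
      push_cast
      ring
  rw [key] at h
  have h2 : (PowerSeries.X : ℂ[X]⟦X⟧) ^ M ∣
      (M.factorial : ℂ[X]⟦X⟧) * PowerSeries.X ^ (M + 1) * divDer M x.series :=
    ((pow_dvd_pow _ (Nat.le_succ M)).mul_left _).mul_right _
  rw [series_b_mul, series_mul]
  have := (dvd_neg (a := (PowerSeries.X : ℂ[X]⟦X⟧) ^ M)).2 (dvd_sub h h2)
  convert this using 1
  ring

theorem b_pow_mul_eq (n : ℕ) (x : ATilde) : ∃ y : ATilde, b ^ n * x = y * b ^ n := by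
  induction n generalizing x with
  | zero => exact ⟨x, by simp⟩
  | succ n ih =>
    obtain ⟨y, hy⟩ := ih ⟨x.series - PowerSeries.X * divDer 1 x.series⟩
    exact ⟨y, by rw [pow_succ, mul_assoc, b_mul_eq, ← mul_assoc, hy, mul_assoc]⟩

theorem b_mul_cancel {x : ATilde} (h : b * x = 0) : x = 0 := by
  have h' := congrArg series h
  rw [series_b_mul] at h'
  exact ATilde.ext ((mul_eq_zero.1 h').resolve_left PowerSeries.X_ne_zero)

theorem mul_b_cancel {x : ATilde} (h : x * b = 0) : x = 0 := by
  have step : ∀ y : ATilde, y * b = 0 → ∃ z : ATilde, y = b * z ∧ z * b = 0 := by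
    intro y hy
    have h2 := dvd_star_sub 2 y.series b.series
    rw [← series_mul, hy, Finset.sum_range_succ, Finset.sum_range_one, divDer_zero, series_b,
      bsqDer_pow_succ_X, bsqDer_pow_succ_X, PowerSeries.X_pow_dvd_iff] at h2
    have h3 := h2 1 (by norm_num)
    have h4 : PowerSeries.X ∣ y.series := by
      rw [PowerSeries.X_dvd_iff, ← PowerSeries.coeff_zero_eq_constantCoeff_apply]
      have e : y.series * ((Nat.factorial 0 : ℂ[X]⟦X⟧) * PowerSeries.X ^ (0 + 1)) +
          divDer 1 y.series * ((Nat.factorial 1 : ℂ[X]⟦X⟧) * PowerSeries.X ^ (1 + 1)) =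
          PowerSeries.X * (y.series + PowerSeries.X * divDer 1 y.series) := by
        simp; ring
      rw [e, series_zero, zero_sub, map_neg, neg_eq_zero,
        show (1 : ℕ) = 0 + 1 from rfl, PowerSeries.coeff_succ_X_mul] at h3
      simpa using h3
    obtain ⟨g, hg⟩ := h4
    have e2 : y = b * ⟨g⟩ := ATilde.ext (by rw [series_b_mul, hg])
    refine ⟨⟨g⟩, e2, b_mul_cancel ?_⟩
    rw [← mul_assoc, ← e2]
    exact hy
  have all : ∀ M : ℕ, ∀ y : ATilde, y * b = 0 → (PowerSeries.X : ℂ[X]⟦X⟧) ^ M ∣ y.series := by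
    intro M
    induction M with
    | zero => intro y _; simp
    | succ M ih =>
      intro y hy
      obtain ⟨z, hyz, hz⟩ := step y hy
      rw [hyz, series_b_mul, pow_succ']
      exact mul_dvd_mul_left _ (ih z hz)
  exact ATilde.ext (eq_of_dvd fun M => by rw [series_zero, sub_zero]; exact all M x h)

theorem mul_b_pow_cancel (n : ℕ) {x y : ATilde} (h : x * b ^ n = y * b ^ n) : x = y := by
  induction n with
  | zero => simpa using h
  | succ n ih =>
    refine ih (sub_eq_zero.1 (mul_b_cancel ?_))
    rw [sub_mul, mul_assoc, mul_assoc, ← pow_succ, h, sub_self]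

end ATilde

open ATilde

/-- The powers of `b`. -/
def bPowers : Submonoid ATilde := Submonoid.powers b

theorem ore_exists (r : ATilde) (s : bPowers) : ∃ r' : ATilde, (s : ATilde) * r = r' * s := by
  obtain ⟨n, hn⟩ := (Submonoid.mem_powers_iff _ _).1 s.2
  rw [← hn]
  exact b_pow_mul_eq n r

theorem ore_cancel (r₁ r₂ : ATilde) (s : bPowers) (h : r₁ * (s : ATilde) = r₂ * s) : r₁ = r₂ := by
  obtain ⟨n, hn⟩ := (Submonoid.mem_powers_iff _ _).1 s.2
  rw [← hn] at h
  exact mul_b_pow_cancel n h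

instance : OreLocalization.OreSet bPowers where
  ore_right_cancel r₁ r₂ s h := ⟨1, by rw [ore_cancel r₁ r₂ s h]⟩
  oreNum r s := (ore_exists r s).choose
  oreDenom _ s := s
  ore_eq r s := (ore_exists r s).choose_spec

/-- The element `b` as a member of `bPowers`. -/
def bMem : bPowers := ⟨b, Submonoid.mem_powers b⟩

/-- The algebra `Ã[b⁻¹]`. -/
abbrev ATildeLoc : Type := OreLocalization bPowers ATilde

/-- The canonical map `Ã → Ã[b⁻¹]`. -/
def toLoc : ATilde →+* ATildeLoc := OreLocalization.numeratorRingHom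

/-- The element `b⁻¹` of `Ã[b⁻¹]`. -/
def bInv : ATildeLoc := OreLocalization.oreDiv 1 bMem

theorem toLoc_injective : Function.Injective toLoc := by
  refine OreLocalization.numeratorHom_inj fun s hs => ?_
  obtain ⟨n, hn⟩ := (Submonoid.mem_powers_iff _ _).1 hs
  rw [mem_nonZeroDivisorsLeft_iff, ← hn]
  clear hn
  intro x hx
  induction n with
  | zero => rwa [pow_zero, one_mul] at hx
  | succ n ih =>
    rw [pow_succ', mul_assoc] at hx
    exact ih (b_mul_cancel hx)

theorem bInv_mul_b : bInv * toLoc b = 1 := by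
  have := (OreLocalization.numeratorUnit bMem).inv_val
  exact this

theorem b_mul_bInv : toLoc b * bInv = 1 := by
  have := (OreLocalization.numeratorUnit bMem).val_inv
  exact this

/-! ### (a,b)-modules, regularity and the Bernstein polynomial -/

section Modules

variable (E : Type*) [AddCommGroup E] [Module ATilde E]

/-- A left `Ã`-module is an (a,b)-module if it is free of finite type over `ℂ⟦b⟧`. -/
def IsABModule : Prop :=
  letI : Module ℂ⟦X⟧ E := Module.compHom E ofB
  Module.Free ℂ⟦X⟧ E ∧ Module.Finite ℂ⟦X⟧ E

/-- The rank of an (a,b)-module, as a module over `ℂ⟦b⟧`. -/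
def abRank : ℕ :=
  letI : Module ℂ⟦X⟧ E := Module.compHom E ofB
  Module.finrank ℂ⟦X⟧ E

/-- The localisation `E[b⁻¹]`. -/
def Loc : Type _ := OreLocalization bPowers E

instance : AddCommGroup (Loc E) := inferInstanceAs (AddCommGroup (OreLocalization bPowers E))

instance : Module ATildeLoc (Loc E) :=
  inferInstanceAs (Module (OreLocalization bPowers ATilde) (OreLocalization bPowers E))

instance : Module ℂ⟦X⟧ (Loc E) := Module.compHom (Loc E) (toLoc.comp ofB)

instance : Module ℂ (Loc E) := Module.compHom (Loc E) (algebraMap ℂ ATildeLoc)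

/-- The canonical map `E → E[b⁻¹]`. -/
def toLocMod (e : E) : Loc E := OreLocalization.oreDiv e (1 : bPowers)

theorem powerSeries_smul_def (S : ℂ⟦X⟧) (v : Loc E) : S • v = toLoc (ofB S) • v := rfl

theorem complex_smul_def (c : ℂ) (v : Loc E) : c • v = algebraMap ℂ ATildeLoc c • v := rfl

instance : IsScalarTower ℂ ℂ⟦X⟧ (Loc E) where
  smul_assoc c S v := by
    have h : toLoc (ofB (PowerSeries.C c)) = algebraMap ℂ ATildeLoc c := rfl
    rw [powerSeries_smul_def, complex_smul_def, powerSeries_smul_def, PowerSeries.smul_eq_C_mul,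
      map_mul, map_mul, mul_smul, h]

/-- The action of an element of `Ã[b⁻¹]` on `E[b⁻¹]`. -/
def act (t : ATildeLoc) : Module.End ℂ (Loc E) where
  toFun v := t • v
  map_add' := smul_add t
  map_smul' c v := by
    rw [RingHom.id_apply, complex_smul_def, complex_smul_def, ← mul_smul, ← mul_smul,
      Algebra.commutes]

/-- The saturation `E♯` of `E` by `b⁻¹a` in `E[b⁻¹]`: the smallest `ℂ⟦b⟧`-submodule that
contains the image of `E` and is stable by `b⁻¹a`. -/
def saturation : Submodule ℂ⟦X⟧ (Loc E) :=
  sInf {F | (∀ e : E, toLocMod E e ∈ F) ∧ ∀ v ∈ F, (bInv * toLoc a) • v ∈ F}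

theorem smul_mem_saturation {v : Loc E} (hv : v ∈ saturation E) :
    (bInv * toLoc a) • v ∈ saturation E := by
  rw [saturation, Submodule.mem_sInf] at hv ⊢
  exact fun F hF => hF.2 v (hv F hF)

/-- An (a,b)-module `E` is regular if `E♯` is of finite type over `ℂ⟦b⟧`. -/
def IsRegular : Prop := IsABModule E ∧ (saturation E).FG

/-- `E♯` as a complex vector space. -/
abbrev satC : Submodule ℂ (Loc E) := (saturation E).restrictScalars ℂ

theorem b_smul_mem {v : Loc E} (hv : v ∈ satC E) : act E (toLoc b) v ∈ satC E :=
  (saturation E).smul_mem PowerSeries.X hv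

/-- The action of `b` on `E♯`. -/
def satB : Module.End ℂ (satC E) := (act E (toLoc b)).restrict fun _ hv => b_smul_mem E hv

/-- The action of `- b⁻¹a` on `E♯`. -/
def satNeg : Module.End ℂ (satC E) :=
  (act E (-(bInv * toLoc a))).restrict fun v hv => by
    change (-(bInv * toLoc a)) • v ∈ saturation E
    rw [neg_smul]
    exact (saturation E).neg_mem (smul_mem_saturation E hv)

/-- The quotient `E♯ / b E♯`. -/
abbrev SatQuot : Type _ := satC E ⧸ LinearMap.range (satB E)

theorem act_comm : (-(bInv * toLoc a)) * toLoc b = toLoc b * (-(bInv * toLoc a) - 1) := by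
  have h : toLoc a * toLoc b = toLoc b * toLoc a + toLoc b * toLoc b := by
    rw [← map_mul, ← map_mul, ← map_mul, ← map_add]
    congr 1
    rw [← sub_eq_iff_eq_add', a_mul_b_sub, pow_two]
  rw [neg_mul, mul_assoc, h, mul_add, ← mul_assoc, ← mul_assoc, bInv_mul_b, mul_sub, mul_neg,
    ← mul_assoc, b_mul_bInv]
  simp only [one_mul, mul_one]
  abel

/-- The action of `- b⁻¹a` on `E♯ / b E♯`. -/
def satQuotNeg : Module.End ℂ (SatQuot E) :=
  (LinearMap.range (satB E)).mapQ (LinearMap.range (satB E)) (satNeg E) <| by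
    rintro _ ⟨v, rfl⟩
    refine ⟨satNeg E v - v, Subtype.ext ?_⟩
    change toLoc b • ((-(bInv * toLoc a)) • (v : Loc E) - (v : Loc E)) =
      (-(bInv * toLoc a)) • (toLoc b • (v : Loc E))
    rw [← mul_smul, act_comm, mul_smul, sub_smul, one_smul]

open Classical in
/-- The Bernstein polynomial of a regular (a,b)-module `E`: the characteristic polynomial of
`- b⁻¹a` acting on the finite dimensional complex vector space `E♯ / b E♯`. -/
def bernstein : ℂ[X] :=
  if h : Module.Finite ℂ (SatQuot E) then
    haveI := h
    (satQuotNeg E).charpoly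
  else 0

end Modules

/-! ### Homogeneous elements, degree in `a`, valuation -/

/-- `x` is homogeneous of degree `k` in `(a,b)` and monic in `a`. -/
def IsHomogeneousMonic (k : ℕ) (x : ATilde) : Prop :=
  ∃ c : ℕ → ℂ, c k = 1 ∧ x = ∑ j ∈ Finset.range (k + 1), c j • (a ^ j * b ^ (k - j))

/-- `x` is a polynomial in `a` with coefficients in `ℂ⟦b⟧`, of degree `< k` in `a`. -/
def IsPolyDegreeLT (k : ℕ) (x : ATilde) : Prop :=
  ∃ S : ℕ → ℂ⟦X⟧, x = ∑ j ∈ Finset.range k, ofB (S j) * a ^ j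

/-- The valuation of `x` in `(a,b)`: the least degree `n + j` of a monomial `bⁿ aʲ` that occurs
in `x`, and `⊤` for `x = 0`. -/
def abVal (x : ATilde) : ℕ∞ :=
  ⨅ (p : ℕ × ℕ) (_ : coef x p.1 p.2 ≠ 0), ((p.1 + p.2 : ℕ) : ℕ∞)

/-- The condition on the pair `(P, R)` in the standard form `P + b² R` of a generator. -/
structure IsStandardPair (k : ℕ) (P R : ATilde) : Prop where
  homogeneous : IsHomogeneousMonic k P
  degree : IsPolyDegreeLT k R
  valuation : ((k - 1 : ℕ) : ℕ∞) ≤ abVal R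

end AB

end

namespace AB

namespace ATilde

/-! ### Expansions in powers of `b` -/

/-! The standard form $P+b^2R$ is the same thing as $x=a^k+\sum_{j<k}V_j(b)\,b^{k-j}a^j$ with
$V_j\in\mathbb C[[b]]$, and $P$ is obtained by replacing each $V_j$ by $V_j(0)$
(`IsStandardPair.exists_weighted`, `exists_isStandardPair`). For a generator $e$ of $E$, put
$f_j=b^{-j}a^je$ in $E[b^{-1}]$. Then $xe=b^k\bigl(f_k+\sum_{j<k}V_jf_j\bigr)$, so $xe=0$ is a
relation expressing $f_k$ by the earlier $f_j$ with coefficients in $\mathbb C[[b]]$. Since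
$b^{-1}a\,f_j=f_{j+1}-jf_j$, such a relation makes the span of $f_0,\dots,f_{k-1}$ stable under
$b^{-1}a$.

If $I$ is generated by $x$, division by $x$ with unique remainder (`exists_eq_mul_add`,
`eq_zero_of_mul_add_eq_zero`) makes $e,\dots,a^{k-1}e$ a basis of $E$. The $f_j$ with $j<k$ are then
a basis of $E^\sharp$, so $E$ is regular of rank $k$. Uniqueness of division also shows that $I$
determines $x$, and $x$ determines $P$ and $R$ because they occupy different total degrees.

Conversely, let $E=\tilde{\mathcal A}e$ be regular. Take the least $n$ with $f_n\in\langle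
f_0,\dots,f_{n-1}\rangle+bE^\sharp$. By Nakayama the $f_j$ with $j<n$ generate $E^\sharp$, by
minimality they are independent, and $n$ is the rank. The resulting relation for $f_n$ is the
generator sought (`IsRegular.exists_isCyclicGenerator`).

For the Bernstein polynomial, $b^{-j}a^j$ is the rising factorial of length $j$ in $t=b^{-1}a$
(`aeval_ascPochhammer`). So the class of $e$ is a cyclic vector of the $k$-dimensional space
$E^\sharp/bE^\sharp$. The relation modulo $b$ says that it is killed by the monic polynomial $p(t)$
of degree $k$ with $b^kp(b^{-1}a)=P$. Hence $(-1)^kp(-x)$ is both the minimal and the characteristic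
polynomial of $-b^{-1}a$, and $P$ is recovered from $B_E$ and the rank. -/

theorem series_b_pow_mul (n : ℕ) (x : ATilde) :
    (b ^ n * x).series = PowerSeries.X ^ n * x.series := by
  induction n generalizing x with
  | zero => simp
  | succ n ih => rw [pow_succ, mul_assoc, ih, series_b_mul, pow_succ, mul_assoc]

theorem b_pow_dvd_iff {n : ℕ} {x : ATilde} :
    b ^ n ∣ x ↔ (PowerSeries.X : ℂ[X]⟦X⟧) ^ n ∣ x.series := by
  constructor
  · rintro ⟨y, rfl⟩
    exact ⟨y.series, series_b_pow_mul n y⟩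
  · rintro ⟨g, hg⟩
    exact ⟨⟨g⟩, ATilde.ext (by rw [series_b_pow_mul, hg])⟩

theorem eq_zero_of_b_pow_dvd {x : ATilde} (h : ∀ n : ℕ, b ^ n ∣ x) : x = 0 :=
  ATilde.ext (eq_of_dvd fun M => by
    rw [series_zero, sub_zero]; exact b_pow_dvd_iff.1 (h M))

/-- The class of `x` modulo `b`. -/
noncomputable def residue (x : ATilde) : ℂ[X] := PowerSeries.coeff 0 x.series

theorem residue_add (x y : ATilde) : residue (x + y) = residue x + residue y := by
  simp [residue]

theorem residue_sub (x y : ATilde) : residue (x - y) = residue x - residue y := by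
  simp [residue]

/-- Only the term $i=0$ of the product reaches $b^0$, so $\tilde{\mathcal A}$ modulo $b$ is the
commutative ring $\mathbb C[a]$, where Euclidean division is available. -/
theorem residue_mul (x y : ATilde) : residue (x * y) = residue x * residue y := by
  simp [residue, series_mul, starMul, divDer_zero]

theorem b_dvd_iff {x : ATilde} : b ∣ x ↔ residue x = 0 := by
  have := b_pow_dvd_iff (n := 1) (x := x)
  rw [pow_one, pow_one, PowerSeries.X_dvd_iff] at this
  rw [this, residue, PowerSeries.coeff_zero_eq_constantCoeff_apply]

/-- The polynomial in `a` with complex coefficients. -/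
noncomputable def ofA (Y : ℂ[X]) : ATilde := ⟨PowerSeries.C Y⟩

theorem residue_ofA (Y : ℂ[X]) : residue (ofA Y) = Y := by
  simp [residue, ofA]

theorem ext_coef {x y : ATilde} (h : ∀ n j, coef x n j = coef y n j) : x = y := by
  refine ATilde.ext ?_
  ext n j
  exact h n j

theorem coef_add (x y : ATilde) (n j : ℕ) : coef (x + y) n j = coef x n j + coef y n j := by
  simp [coef]

theorem coef_sub (x y : ATilde) (n j : ℕ) : coef (x - y) n j = coef x n j - coef y n j := by
  simp [coef]

theorem coef_zero (n j : ℕ) : coef 0 n j = 0 := by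
  simp [coef]

theorem coef_sum {ι : Type*} (s : Finset ι) (f : ι → ATilde) (n j : ℕ) :
    coef (∑ i ∈ s, f i) n j = ∑ i ∈ s, coef (f i) n j := by
  classical
  induction s using Finset.induction_on with
  | empty => simp [coef_zero]
  | insert i s hi ih => rw [Finset.sum_insert hi, Finset.sum_insert hi, coef_add, ih]

theorem coef_sum_ofB_mul_a_pow (s : Finset ℕ) (S : ℕ → ℂ⟦X⟧) (n j : ℕ) :
    coef (∑ i ∈ s, ofB (S i) * a ^ i) n j = if j ∈ s then PowerSeries.coeff n (S j) else 0 := by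
  rw [coef_sum]
  simp_rw [coef_ofB_mul_a_pow]
  rw [Finset.sum_ite_eq]

theorem coef_b_pow_mul_add (x : ATilde) (m n j : ℕ) : coef (b ^ m * x) (n + m) j = coef x n j := by
  rw [coef, series_b_pow_mul, PowerSeries.coeff_X_pow_mul, coef]

theorem coef_b_pow_mul_of_lt (x : ATilde) {m n : ℕ} (h : n < m) (j : ℕ) :
    coef (b ^ m * x) n j = 0 := by
  rw [coef, series_b_pow_mul, PowerSeries.coeff_X_pow_mul', if_neg (by omega), Polynomial.coeff_zero]

/-- An element with coefficients vanishing in `a`-degree `≥ k` is a polynomial in `a`. -/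
theorem eq_sum_of_coef_eq_zero {k : ℕ} {x : ATilde} (h : ∀ n j, k ≤ j → coef x n j = 0) :
    x = ∑ j ∈ Finset.range k, ofB (PowerSeries.mk fun n => coef x n j) * a ^ j := by
  refine ext_coef fun n j => ?_
  rw [coef_sum_ofB_mul_a_pow]
  split_ifs with hj
  · simp
  · exact h n j (by simpa using hj)

theorem ofB_X_pow (n : ℕ) : ofB (PowerSeries.X ^ n) = b ^ n := by rw [map_pow, b]

theorem b_cancel {x y : ATilde} (h : b * x = b * y) : x = y :=
  sub_eq_zero.1 (b_mul_cancel (by rw [mul_sub, h, sub_self]))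

theorem b_pow_cancel {n : ℕ} {x y : ATilde} (h : b ^ n * x = b ^ n * y) : x = y := by
  induction n with
  | zero => simpa using h
  | succ n ih =>
    rw [pow_succ', mul_assoc, mul_assoc] at h
    exact ih (b_cancel h)

/-! ### Division -/

/-- Division by an element that is monic of degree `k` in `a` modulo `b`. -/
theorem exists_eq_mul_add {k : ℕ} {x : ATilde} (hx : residue x = Polynomial.X ^ k) (y : ATilde) :
    ∃ (q : ATilde) (S : ℕ → ℂ⟦X⟧), y = q * x + ∑ j ∈ Finset.range k, ofB (S j) * a ^ j := by
  have hm : (Polynomial.X ^ k : ℂ[X]).Monic := Polynomial.monic_X_pow k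
  -- Euclidean division of the residue in $\mathbb C[a]$ leaves an error divisible by $b$; iterating
  -- on the cofactor produces the quotient and the remainder one power of $b$ at a time.
  have step : ∀ z : ATilde, ∃ z' : ATilde, z =
      ofA (residue z /ₘ Polynomial.X ^ k) * x + ofA (residue z %ₘ Polynomial.X ^ k) + b * z' := by
    intro z
    obtain ⟨z', hz'⟩ : b ∣ z - (ofA (residue z /ₘ Polynomial.X ^ k) * x +
        ofA (residue z %ₘ Polynomial.X ^ k)) := by
      rw [b_dvd_iff, residue_sub, residue_add, residue_mul, residue_ofA, residue_ofA, hx, sub_eq_zero,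
        add_comm, mul_comm, Polynomial.modByMonic_add_div]
    exact ⟨z', by rw [← hz']; abel⟩
  choose next hnext using step
  let z : ℕ → ATilde := fun n => next^[n] y
  have hz : ∀ n, z (n + 1) = next (z n) := fun n => Function.iterate_succ_apply' next n y
  let q : ATilde := ⟨PowerSeries.mk fun n => residue (z n) /ₘ Polynomial.X ^ k⟩
  let r : ATilde := ⟨PowerSeries.mk fun n => residue (z n) %ₘ Polynomial.X ^ k⟩
  have expand : ∀ n, y = (∑ i ∈ Finset.range n, b ^ i * ofA (residue (z i) /ₘ Polynomial.X ^ k)) * x +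
      (∑ i ∈ Finset.range n, b ^ i * ofA (residue (z i) %ₘ Polynomial.X ^ k)) + b ^ n * z n := by
    intro n
    induction n with
    | zero => simp [z]
    | succ n ih =>
      rw [Finset.sum_range_succ, Finset.sum_range_succ, hz]
      have h1 := congrArg (b ^ n * ·) (hnext (z n))
      simp only [mul_add, ← mul_assoc, ← pow_succ] at h1
      rw [h1] at ih
      rw [add_mul]
      exact ih.trans (by abel)
  have trunc : ∀ (F : ℕ → ℂ[X]) (n : ℕ),
      b ^ n ∣ (⟨PowerSeries.mk F⟩ : ATilde) - ∑ i ∈ Finset.range n, b ^ i * ofA (F i) := by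
    intro F n
    rw [b_pow_dvd_iff, PowerSeries.X_pow_dvd_iff]
    intro m hm
    ext j
    change coef _ m j = _
    rw [coef_sub, coef_sum, Polynomial.coeff_zero, sub_eq_zero, Finset.sum_eq_single m]
    · have := coef_b_pow_mul_add (ofA (F m)) m 0 j
      rw [zero_add] at this
      rw [this, coef, coef, ofA, PowerSeries.coeff_mk, PowerSeries.coeff_zero_C]
    · intro i _ hi
      rcases lt_or_gt_of_ne hi with h | h
      · obtain ⟨d, rfl⟩ := Nat.exists_eq_add_of_lt h
        have := coef_b_pow_mul_add (ofA (F i)) i (d + 1) j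
        rw [show i + d + 1 = d + 1 + i by ring, this, coef, ofA, PowerSeries.coeff_C,
          if_neg (Nat.succ_ne_zero d), Polynomial.coeff_zero]
      · exact coef_b_pow_mul_of_lt _ h j
    · intro h; exact absurd (Finset.mem_range.2 hm) h
  -- The powers of $b$ stand on the left and $x$ on the right, so the truncation error of the
  -- quotient keeps its factor $b^n$ after multiplication by $x$.
  have hy : y = q * x + r := by
    rw [← sub_eq_zero]
    refine eq_zero_of_b_pow_dvd fun n => ?_
    obtain ⟨c, hc⟩ := trunc (fun n => residue (z n) /ₘ Polynomial.X ^ k) n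
    obtain ⟨d, hd⟩ := trunc (fun n => residue (z n) %ₘ Polynomial.X ^ k) n
    refine ⟨z n - c * x - d, ?_⟩
    rw [mul_sub, mul_sub, ← hd, ← mul_assoc, ← hc]
    nth_rewrite 1 [expand n]
    rw [sub_mul]
    simp only [q, r]
    abel
  have hr : ∀ n j, k ≤ j → coef r n j = 0 := by
    intro n j hj
    rw [coef, PowerSeries.coeff_mk]
    refine Polynomial.coeff_eq_zero_of_degree_lt ((Polynomial.degree_modByMonic_lt _ hm).trans_le ?_)
    rw [Polynomial.degree_X_pow]
    exact_mod_cast hj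
  exact ⟨q, _, by rw [← eq_sum_of_coef_eq_zero hr, ← hy]⟩

/-- Uniqueness of the division by an element that is monic of degree `k` in `a` modulo `b`. -/
theorem eq_zero_of_mul_add_eq_zero {k : ℕ} {x : ATilde} (hx : residue x = Polynomial.X ^ k)
    {q : ATilde} {S : ℕ → ℂ⟦X⟧} (h : q * x + ∑ j ∈ Finset.range k, ofB (S j) * a ^ j = 0) :
    q = 0 ∧ ∀ j < k, S j = 0 := by
  -- Modulo $b$, the part of degree $\ge k$ in $a$ gives $b\mid q$, and then $b\mid r$; cancelling
  -- $b$ gives an equation of the same shape.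
  have key : ∀ (n : ℕ) (q : ATilde) (r : ATilde), (∀ n j, k ≤ j → coef r n j = 0) →
      q * x + r = 0 → b ^ n ∣ q := by
    intro n
    induction n with
    | zero => intro q r _ _; simp
    | succ n ih =>
      intro q r hr h
      have h0 : residue q * Polynomial.X ^ k + residue r = 0 := by
        rw [← hx, ← residue_mul, ← residue_add, h]; simp [residue]
      have hq : residue q = 0 := by
        ext i
        have := congrArg (fun p => Polynomial.coeff p (i + k)) h0
        simp only [Polynomial.coeff_add, Polynomial.coeff_mul_X_pow, Polynomial.coeff_zero] at this
        have h2 : (residue r).coeff (i + k) = 0 := hr 0 (i + k) (by omega)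
        rwa [h2, add_zero] at this
      have hr0 : residue r = 0 := by simpa [hq] using h0
      obtain ⟨q', rfl⟩ := b_dvd_iff.2 hq
      obtain ⟨r', rfl⟩ := b_dvd_iff.2 hr0
      rw [pow_succ']
      refine mul_dvd_mul_left b (ih q' r' (fun m j hj => ?_) ?_)
      · have := coef_b_pow_mul_add r' 1 m j
        rw [pow_one] at this
        rw [← this]
        exact hr _ j hj
      · refine b_mul_cancel ?_
        rw [mul_add, ← mul_assoc, h]
  have hq : q = 0 := eq_zero_of_b_pow_dvd fun n => key n q _ (fun n j hj => by
    rw [coef_sum_ofB_mul_a_pow, if_neg (by simpa using hj)]) h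
  refine ⟨hq, fun j hj => ?_⟩
  rw [hq, zero_mul, zero_add] at h
  ext n
  have := coef_sum_ofB_mul_a_pow (Finset.range k) S n j
  rw [h, if_pos (Finset.mem_range.2 hj), coef_zero] at this
  rw [← this, map_zero]

/-! ### Commutation with `a` -/

/-- As $\partial_a^2a=0$, only the terms $i=0,1$ of the product survive: $[a,S]=b^2S'$. -/
theorem a_mul_ofB (S : ℂ⟦X⟧) :
    a * ofB S = ofB S * a + ofB (PowerSeries.X ^ 2 * PowerSeries.derivative ℂ S) := by
  have h0 : ∀ i, divDer (i + 1 + 1) a.series = 0 := by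
    intro i
    ext1 n
    rw [coeff_divDer, a, PowerSeries.coeff_C, map_zero]
    split_ifs
    · exact Polynomial.hasseDeriv_X _ (by omega)
    · simp
  have h1 : divDer 1 a.series = 1 := by
    ext1 n
    rw [coeff_divDer, a, PowerSeries.coeff_C, PowerSeries.coeff_one]
    split_ifs <;> simp
  have h2 : bsqDer (ofB S).series = (ofB (PowerSeries.X ^ 2 * PowerSeries.derivative ℂ S)).series := by
    change PowerSeries.X ^ 2 * PowerSeries.derivative ℂ[X] (PowerSeries.map Polynomial.C S) =
      PowerSeries.map Polynomial.C _
    rw [map_mul, map_pow, PowerSeries.map_X]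
    congr 1
    ext1 n
    simp [PowerSeries.coeff_derivative]
  refine ATilde.ext (eq_of_dvd fun M => ?_)
  have h := dvd_star_sub (M + 2) a.series (ofB S).series
  rw [← series_mul, Finset.sum_range_succ', Finset.sum_range_succ',
    Finset.sum_eq_zero fun i _ => by rw [h0, zero_mul]] at h
  refine (pow_dvd_pow _ (Nat.le_add_right M 2)).trans ?_
  convert h using 2
  rw [series_add, series_ofB_mul, zero_add, zero_add, h1, divDer_zero, pow_one, one_mul, h2, pow_zero,
    Module.End.one_apply, series_ofB, mul_comm, add_comm]
  rfl

theorem a_mul_b_pow (n : ℕ) : a * b ^ n = b ^ n * a + (n : ℂ) • b ^ (n + 1) := by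
  induction n with
  | zero => simp
  | succ n ih =>
    have e : a * b = b * a + b ^ 2 := by rw [← a_mul_b_sub]; abel
    rw [pow_succ, ← mul_assoc, ih, add_mul, mul_assoc, e, smul_mul_assoc, ← pow_succ, mul_add,
      ← mul_assoc, ← pow_add]
    push_cast
    rw [add_smul, one_smul]
    abel

theorem ofB_C_mul (c : ℂ) (x : ATilde) : ofB (PowerSeries.C c) * x = c • x :=
  (Algebra.smul_def c x).symm

end ATilde

open ATilde

/-! ### Homogeneous elements -/

/-- Moving one $a$ across $b^n$ costs $n\,b^{n+1}$, which keeps the total degree but lowers the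
degree in $a$: reordering is unitriangular. -/
theorem exists_a_pow_mul_b_pow (j n : ℕ) : ∃ c : ℕ → ℂ, c j = 1 ∧ (∀ i, j < i → c i = 0) ∧
    a ^ j * b ^ n = ∑ i ∈ Finset.range (j + 1), c i • (b ^ (n + j - i) * a ^ i) := by
  induction j generalizing n with
  | zero => exact ⟨fun i => if i = 0 then 1 else 0, by simp, by intro i hi; simp; omega, by simp⟩
  | succ j ih =>
    obtain ⟨c, hc, hc0, h⟩ := ih n
    obtain ⟨d, hd, hd0, h'⟩ := ih (n + 1)
    -- The first summand is the expansion of $a^jb^n$ shifted by the extra $a$ on the right, hence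
    -- no constant term; the second is the correction $n\,a^jb^{n+1}$.
    refine ⟨fun i => (if i = 0 then 0 else c (i - 1)) + n * d i, ?_, ?_, ?_⟩
    · simp [hc, hd0]
    · intro i hi
      beta_reduce
      rw [if_neg (by omega), hc0 _ (by omega), hd0 _ (by omega)]; simp
    · rw [pow_succ, mul_assoc, a_mul_b_pow, mul_add, ← mul_assoc, h, mul_smul_comm, h', Finset.sum_mul,
        Finset.smul_sum]
      simp_rw [add_smul, Finset.sum_add_distrib]
      congr 1
      · rw [Finset.sum_range_succ' _ (j + 1)]
        simp only [Nat.succ_ne_zero, if_false, if_true, zero_smul, add_zero, Nat.add_sub_cancel]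
        refine Finset.sum_congr rfl fun i _ => ?_
        rw [smul_mul_assoc, mul_assoc, ← pow_succ, show n + (j + 1) - (i + 1) = n + j - i by omega]
      · rw [Finset.sum_range_succ _ (j + 1), hd0 _ (Nat.lt_succ_self j)]
        simp only [mul_zero, zero_smul, add_zero]
        refine Finset.sum_congr rfl fun i _ => ?_
        rw [smul_smul, show n + (j + 1) - i = n + 1 + j - i by omega]

theorem exists_b_pow_mul_a_pow (j n : ℕ) : ∃ c : ℕ → ℂ, c j = 1 ∧ (∀ i, j < i → c i = 0) ∧
    b ^ n * a ^ j = ∑ i ∈ Finset.range (j + 1), c i • (a ^ i * b ^ (n + j - i)) := by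
  induction j generalizing n with
  | zero => exact ⟨fun i => if i = 0 then 1 else 0, by simp, by intro i hi; simp; omega, by simp⟩
  | succ j ih =>
    obtain ⟨c, hc, hc0, h⟩ := ih n
    obtain ⟨d, hd, hd0, h'⟩ := ih (n + 1)
    refine ⟨fun i => (if i = 0 then 0 else c (i - 1)) + (-n) * d i, ?_, ?_, ?_⟩
    · simp [hc, hd0]
    · intro i hi
      beta_reduce
      rw [if_neg (by omega), hc0 _ (by omega), hd0 _ (by omega)]; simp
    · have e : b ^ n * a = a * b ^ n + (-n : ℂ) • b ^ (n + 1) := by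
        rw [a_mul_b_pow, neg_smul]; abel
      rw [pow_succ', ← mul_assoc, e, add_mul, mul_assoc, h, smul_mul_assoc, h', Finset.mul_sum,
        Finset.smul_sum]
      simp_rw [add_smul, Finset.sum_add_distrib]
      congr 1
      · rw [Finset.sum_range_succ' _ (j + 1)]
        simp only [Nat.succ_ne_zero, if_false, if_true, zero_smul, add_zero, Nat.add_sub_cancel]
        refine Finset.sum_congr rfl fun i _ => ?_
        rw [mul_smul_comm, ← mul_assoc, ← pow_succ', show n + (j + 1) - (i + 1) = n + j - i by omega]
      · rw [Finset.sum_range_succ _ (j + 1), hd0 _ (Nat.lt_succ_self j)]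
        simp only [mul_zero, zero_smul, add_zero]
        refine Finset.sum_congr rfl fun i _ => ?_
        rw [smul_smul, show n + (j + 1) - i = n + 1 + j - i by omega]

/-- A unitriangular change of spanning family preserves the combinations with leading
coefficient `1`. -/
theorem exists_sum_of_triangular {u v : ℕ → ATilde} {k : ℕ}
    (h : ∀ j ≤ k, ∃ c : ℕ → ℂ, c j = 1 ∧ (∀ i, j < i → c i = 0) ∧
      u j = ∑ i ∈ Finset.range (j + 1), c i • v i) {c : ℕ → ℂ} (hc : c k = 1) :
    ∃ d : ℕ → ℂ, d k = 1 ∧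
      ∑ j ∈ Finset.range (k + 1), c j • u j = ∑ j ∈ Finset.range (k + 1), d j • v j := by
  have h' : ∀ j : ℕ, ∃ c : ℕ → ℂ, j ≤ k → (c j = 1 ∧ (∀ i, j < i → c i = 0) ∧
      u j = ∑ i ∈ Finset.range (j + 1), c i • v i) := by
    intro j
    by_cases hj : j ≤ k
    · obtain ⟨c, hc⟩ := h j hj
      exact ⟨c, fun _ => hc⟩
    · exact ⟨0, fun h => absurd h hj⟩
  choose m hm using h'
  refine ⟨fun i => ∑ j ∈ Finset.range (k + 1), c j * m j i, ?_, ?_⟩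
  · change ∑ j ∈ Finset.range (k + 1), c j * m j k = 1
    rw [Finset.sum_range_succ, Finset.sum_eq_zero, (hm k le_rfl).1, hc]
    · simp
    · intro j hj
      have := Finset.mem_range.1 hj
      rw [(hm j this.le).2.1 k this, mul_zero]
  · simp_rw [Finset.sum_smul]
    rw [Finset.sum_comm]
    refine Finset.sum_congr rfl fun j hj => ?_
    have hj' : j ≤ k := Nat.lt_succ_iff.1 (Finset.mem_range.1 hj)
    nth_rewrite 1 [(hm j hj').2.2]
    rw [Finset.smul_sum]
    simp_rw [smul_smul]
    refine Finset.sum_subset (Finset.range_mono (by omega)) fun i _ hi => ?_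
    rw [(hm j hj').2.1 i (by simpa using hi), mul_zero, zero_smul]

/-- Homogeneous monic elements in normally ordered form. -/
theorem isHomogeneousMonic_iff {k : ℕ} {P : ATilde} : IsHomogeneousMonic k P ↔
    ∃ v : ℕ → ℂ, v k = 1 ∧ P = ∑ j ∈ Finset.range (k + 1), v j • (b ^ (k - j) * a ^ j) := by
  constructor
  · rintro ⟨c, hc, rfl⟩
    refine exists_sum_of_triangular (u := fun j => a ^ j * b ^ (k - j)) (fun j hj => ?_) hc
    have := exists_a_pow_mul_b_pow j (k - j)
    rwa [Nat.sub_add_cancel hj] at this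
  · rintro ⟨c, hc, rfl⟩
    refine exists_sum_of_triangular (u := fun j => b ^ (k - j) * a ^ j) (fun j hj => ?_) hc
    have := exists_b_pow_mul_a_pow j (k - j)
    rwa [Nat.sub_add_cancel hj] at this

theorem coef_smul_b_pow_mul_a_pow (c : ℂ) (m i n j : ℕ) :
    coef (c • (b ^ m * a ^ i)) n j = if n = m ∧ j = i then c else 0 := by
  rw [← ofB_C_mul, ← ofB_X_pow, ← mul_assoc, ← map_mul, coef_ofB_mul_a_pow,
    PowerSeries.coeff_C_mul_X_pow]
  split_ifs <;> simp_all

theorem IsHomogeneousMonic.coef_eq_zero {k : ℕ} {P : ATilde} (h : IsHomogeneousMonic k P)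
    {n j : ℕ} (hnj : n + j ≠ k) : coef P n j = 0 := by
  obtain ⟨v, -, rfl⟩ := isHomogeneousMonic_iff.1 h
  rw [coef_sum]
  refine Finset.sum_eq_zero fun i hi => ?_
  have := Finset.mem_range.1 hi
  rw [coef_smul_b_pow_mul_a_pow, if_neg (by omega)]

theorem coef_eq_zero_of_lt_abVal {x : ATilde} {n j : ℕ} (h : ((n + j : ℕ) : ℕ∞) < abVal x) :
    coef x n j = 0 := by
  by_contra hne
  exact absurd (iInf₂_le (f := fun (p : ℕ × ℕ) (_ : coef x p.1 p.2 ≠ 0) =>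
    ((p.1 + p.2 : ℕ) : ℕ∞)) (n, j) hne) (not_le.2 h)

theorem IsStandardPair.coef_eq_zero {k : ℕ} {P R : ATilde} (h : IsStandardPair k P R)
    {n j : ℕ} (hnj : n + j + 1 < k) : coef R n j = 0 :=
  coef_eq_zero_of_lt_abVal (lt_of_lt_of_le (by exact_mod_cast (by omega : n + j < k - 1)) h.valuation)

/-- $b^2R$ lives in total degree at least $k+1$, so it cannot interfere with $P$, which lives in
degree exactly $k$. -/
theorem IsStandardPair.coef_b_sq_mul_eq_zero {k : ℕ} {P R : ATilde} (h : IsStandardPair k P R)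
    {n j : ℕ} (hnj : n + j ≤ k) : coef (b ^ 2 * R) n j = 0 := by
  rcases lt_or_ge n 2 with hn | hn
  · exact coef_b_pow_mul_of_lt _ hn j
  · obtain ⟨m, rfl⟩ := Nat.exists_eq_add_of_le' hn
    rw [coef_b_pow_mul_add]
    exact h.coef_eq_zero (by omega)

theorem IsStandardPair.eq_of_add_eq {k : ℕ} {P R P' R' : ATilde} (h : IsStandardPair k P R)
    (h' : IsStandardPair k P' R') (e : P + b ^ 2 * R = P' + b ^ 2 * R') : P = P' ∧ R = R' := by
  have hP : P = P' := ext_coef fun n j => by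
    by_cases hnj : n + j = k
    · have := congrArg (fun x => coef x n j) e
      simpa only [coef_add, h.coef_b_sq_mul_eq_zero hnj.le, h'.coef_b_sq_mul_eq_zero hnj.le,
        add_zero] using this
    · rw [h.homogeneous.coef_eq_zero hnj, h'.homogeneous.coef_eq_zero hnj]
  rw [hP] at e
  exact ⟨hP, b_pow_cancel (add_left_cancel e)⟩

/-! ### The standard form as a weighted monic polynomial in `a` -/

/-- The element `a ^ k + ∑ⱼ Vⱼ(b) b ^ (k - j) a ^ j`. -/
noncomputable def weighted (k : ℕ) (V : ℕ → ℂ⟦X⟧) : ATilde :=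
  a ^ k + ∑ j ∈ Finset.range k, ofB (V j * PowerSeries.X ^ (k - j)) * a ^ j

/-- Each lower term carries $b^{k-j}$ with $k-j\ge1$. This is the hypothesis needed for dividing by
`weighted k V`. -/
theorem residue_weighted (k : ℕ) (V : ℕ → ℂ⟦X⟧) : residue (weighted k V) = Polynomial.X ^ k := by
  have h : residue (∑ j ∈ Finset.range k, ofB (V j * PowerSeries.X ^ (k - j)) * a ^ j) = 0 := by
    rw [← b_dvd_iff]
    refine Finset.dvd_sum fun j hj => ?_
    have := Finset.mem_range.1 hj
    obtain ⟨m, hm⟩ : ∃ m, k - j = m + 1 := ⟨k - j - 1, by omega⟩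
    rw [hm, pow_succ', mul_left_comm, map_mul, mul_assoc]
    exact Dvd.intro _ rfl
  rw [weighted, residue_add, h, add_zero, a_pow]
  exact residue_ofA _

/-- The homogeneous part `a ^ k + ∑ⱼ Vⱼ(0) b ^ (k - j) a ^ j` of `weighted k V`. -/
noncomputable def weightedLead (k : ℕ) (V : ℕ → ℂ⟦X⟧) : ATilde :=
  a ^ k + ∑ j ∈ Finset.range k, PowerSeries.constantCoeff (V j) • (b ^ (k - j) * a ^ j)

/-- The valuation bound on $R=\sum S_ja^j$ forces $S_j=b^{k-1-j}W_j$, so $b^2R$ contributes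
$b^{k-j}\cdot bW_j$. Hence $V_j=v_j+bW_j$, whose constant term is the coefficient $v_j$ of $P$. -/
theorem IsStandardPair.exists_weighted {k : ℕ} {P R : ATilde} (h : IsStandardPair k P R) :
    ∃ V : ℕ → ℂ⟦X⟧, P = weightedLead k V ∧ P + b ^ 2 * R = weighted k V := by
  obtain ⟨v, hv, hP⟩ := isHomogeneousMonic_iff.1 h.homogeneous
  obtain ⟨S, hR⟩ := h.degree
  have hS : ∀ j, ∃ W : ℂ⟦X⟧, j < k → S j = PowerSeries.X ^ (k - 1 - j) * W := by
    intro j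
    by_cases hj : j < k
    · have : PowerSeries.X ^ (k - 1 - j) ∣ S j := by
        rw [PowerSeries.X_pow_dvd_iff]
        intro n hn
        have h2 := coef_sum_ofB_mul_a_pow (Finset.range k) S n j
        rw [← hR, if_pos (Finset.mem_range.2 hj)] at h2
        rw [← h2]
        exact h.coef_eq_zero (by omega)
      obtain ⟨W, hW⟩ := this
      exact ⟨W, fun _ => hW⟩
    · exact ⟨0, fun h => absurd h hj⟩
  choose W hW using hS
  have hlead : P = weightedLead k fun j => PowerSeries.C (v j) + PowerSeries.X * W j := by
    rw [hP, weightedLead, Finset.sum_range_succ, hv, add_comm]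
    simp
  refine ⟨_, hlead, ?_⟩
  rw [hlead, weightedLead, weighted, add_assoc]
  congr 1
  rw [hR, Finset.mul_sum, ← Finset.sum_add_distrib]
  refine Finset.sum_congr rfl fun j hj => ?_
  have := Finset.mem_range.1 hj
  rw [hW j this, ← ofB_C_mul, ← mul_assoc, ← mul_assoc, ← ofB_X_pow, ← ofB_X_pow, ← map_mul, ← map_mul,
    ← add_mul, ← map_add]
  congr 2
  obtain ⟨m, hm⟩ : ∃ m, k - j = m + 1 := ⟨k - j - 1, by omega⟩
  rw [hm, show k - 1 - j = m by omega]
  simp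
  ring

/-- Splitting $V_j=V_j(0)+bW_j$, the constants give $P$ and the $W_j$ give $R$. -/
theorem exists_isStandardPair (k : ℕ) (V : ℕ → ℂ⟦X⟧) :
    ∃ P R : ATilde, IsStandardPair k P R ∧ P + b ^ 2 * R = weighted k V := by
  have hV : ∀ j, ∃ W : ℂ⟦X⟧, V j = PowerSeries.C (PowerSeries.constantCoeff (V j)) +
      PowerSeries.X * W := by
    intro j
    obtain ⟨W, hW⟩ := PowerSeries.X_dvd_iff.2
      (show PowerSeries.constantCoeff (V j - PowerSeries.C (PowerSeries.constantCoeff (V j))) = 0 by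
        simp)
    exact ⟨W, by rw [← hW]; ring⟩
  choose W hW using hV
  refine ⟨weightedLead k V,
    ∑ j ∈ Finset.range k, ofB (PowerSeries.X ^ (k - 1 - j) * W j) * a ^ j, ⟨?_, ?_, ?_⟩, ?_⟩
  · refine isHomogeneousMonic_iff.2
      ⟨fun j => if j = k then 1 else PowerSeries.constantCoeff (V j), by simp, ?_⟩
    rw [weightedLead, Finset.sum_range_succ, add_comm]
    congr 1
    · refine Finset.sum_congr rfl fun j hj => ?_
      have := Finset.mem_range.1 hj
      beta_reduce
      rw [if_neg (by omega)]
    · simp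
  · exact ⟨_, rfl⟩
  · refine le_iInf₂ fun p hp => ?_
    rw [coef_sum_ofB_mul_a_pow] at hp
    split_ifs at hp with h
    · rw [PowerSeries.coeff_X_pow_mul'] at hp
      split_ifs at hp with h2
      · exact_mod_cast (by omega : k - 1 ≤ p.1 + p.2)
      · exact absurd rfl hp
    · exact absurd rfl hp
  · rw [weightedLead, weighted, add_assoc]
    congr 1
    rw [Finset.mul_sum, ← Finset.sum_add_distrib]
    refine Finset.sum_congr rfl fun j hj => ?_
    have := Finset.mem_range.1 hj
    rw [← ofB_C_mul, ← mul_assoc, ← mul_assoc, ← ofB_X_pow, ← ofB_X_pow, ← map_mul, ← map_mul,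
      ← add_mul, ← map_add]
    congr 2
    obtain ⟨m, hm⟩ : ∃ m, k - j = m + 1 := ⟨k - j - 1, by omega⟩
    rw [hm, show k - 1 - j = m by omega]
    conv_rhs => rw [hW j]
    ring

/-- If $x'=qx$, then $(1-q)x+(x'-x)=0$, where $x'-x$ has degree less than $k$ in $a$ because both
are monic; uniqueness of division gives $q=1$. -/
theorem weighted_eq_of_span_eq {k : ℕ} {V V' : ℕ → ℂ⟦X⟧}
    (h : Submodule.span ATilde {weighted k V} = Submodule.span ATilde {weighted k V'}) :
    weighted k V = weighted k V' := by
  have hmem : weighted k V' ∈ Submodule.span ATilde {weighted k V} := by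
    rw [h]; exact Submodule.mem_span_singleton_self _
  obtain ⟨q, hq⟩ := Submodule.mem_span_singleton.1 hmem
  rw [smul_eq_mul] at hq
  have h0 : (1 - q) * weighted k V + ∑ j ∈ Finset.range k,
      ofB ((V' j - V j) * PowerSeries.X ^ (k - j)) * a ^ j = 0 := by
    rw [sub_mul, one_mul, hq, weighted, weighted]
    simp_rw [sub_mul, map_sub, sub_mul, Finset.sum_sub_distrib]
    abel
  have h1 := (eq_zero_of_mul_add_eq_zero (residue_weighted k V) h0).1
  rw [← hq, ← sub_eq_zero, ← one_sub_mul, h1, zero_mul]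

end AB

namespace AB

open ATilde

/-! ### Computations in the localisation -/

theorem toLoc_b_pow_mul_bInv_pow (n : ℕ) : toLoc (b ^ n) * bInv ^ n = 1 := by
  induction n with
  | zero => simp
  | succ n ih =>
    rw [pow_succ, pow_succ', map_mul, mul_assoc, ← mul_assoc (toLoc b), b_mul_bInv, one_mul, ih]

theorem bInv_pow_mul_toLoc_b_pow (n : ℕ) : bInv ^ n * toLoc (b ^ n) = 1 := by
  induction n with
  | zero => simp
  | succ n ih =>
    rw [pow_succ', pow_succ, map_mul, mul_assoc, ← mul_assoc (bInv ^ n), ih, one_mul, bInv_mul_b]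

theorem bInv_mul_a : bInv * toLoc a = toLoc a * bInv + 1 := by
  have h : toLoc a * toLoc b = toLoc b * toLoc a + toLoc b * toLoc b := by
    rw [← map_mul, ← map_mul, ← map_mul, ← map_add]
    congr 1
    rw [← sub_eq_iff_eq_add', a_mul_b_sub, pow_two]
  calc bInv * toLoc a = bInv * (toLoc a * toLoc b) * bInv := by
        rw [mul_assoc, mul_assoc, b_mul_bInv, mul_one]
    _ = bInv * toLoc b * (toLoc a + toLoc b) * bInv := by rw [h]; noncomm_ring
    _ = toLoc a * bInv + 1 := by rw [bInv_mul_b, one_mul, add_mul, b_mul_bInv]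

/-- This gives $b^{-n-1}a^{n+1}=(b^{-1}a+n)\,b^{-n}a^n$, the recursion of the rising factorial. -/
theorem bInv_mul_a_mul_bInv_pow (n : ℕ) :
    bInv * toLoc a * bInv ^ n = bInv ^ (n + 1) * toLoc a - (n : ATildeLoc) * bInv ^ n := by
  induction n with
  | zero => simp
  | succ n ih =>
    have h : toLoc a * bInv = bInv * toLoc a - 1 := by rw [bInv_mul_a]; abel
    rw [pow_succ, ← mul_assoc, ih, sub_mul, mul_assoc (bInv ^ (n + 1)), h, mul_sub, mul_one,
      ← mul_assoc, ← pow_succ, mul_assoc, ← pow_succ]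
    push_cast
    noncomm_ring

theorem bInv_mul_a_mul_bInv_pow_mul_a_pow (n : ℕ) :
    bInv * toLoc a * (bInv ^ n * toLoc (a ^ n)) =
      bInv ^ (n + 1) * toLoc (a ^ (n + 1)) - (n : ATildeLoc) * (bInv ^ n * toLoc (a ^ n)) := by
  rw [← mul_assoc, bInv_mul_a_mul_bInv_pow, sub_mul, mul_assoc, ← map_mul, ← pow_succ', mul_assoc]

/-- `b⁻ⁿ aⁿ` is a polynomial in `b⁻¹a`. -/
theorem aeval_ascPochhammer (n : ℕ) :
    Polynomial.aeval (bInv * toLoc a) (ascPochhammer ℂ n) = bInv ^ n * toLoc (a ^ n) := by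
  induction n with
  | zero => simp
  | succ n ih =>
    rw [ascPochhammer_succ_right, mul_comm, map_mul, ih, map_add, Polynomial.aeval_X, map_natCast,
      add_mul, bInv_mul_a_mul_bInv_pow_mul_a_pow]
    abel

theorem toLoc_b_pow_mul_a_pow {k j : ℕ} (h : j ≤ k) : toLoc (b ^ (k - j) * a ^ j) =
    toLoc (b ^ k) * Polynomial.aeval (bInv * toLoc a) (ascPochhammer ℂ j) := by
  obtain ⟨m, rfl⟩ := Nat.exists_eq_add_of_le' h
  rw [aeval_ascPochhammer, Nat.add_sub_cancel, pow_add, map_mul, map_mul, mul_assoc, ← mul_assoc,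
    ← mul_assoc, mul_assoc (toLoc (b ^ m)), toLoc_b_pow_mul_bInv_pow, mul_one]

/-! ### The map from `E` to `E[b⁻¹]` and the operator `b⁻¹a` -/

section Modules

variable (E : Type*) [AddCommGroup E] [Module ATilde E]

/-- The structure of `ℂ⟦b⟧`-module of an `Ã`-module. -/
noncomputable abbrev abModule : Module ℂ⟦X⟧ E := Module.compHom E ofB

attribute [local instance] abModule

variable {E} in
theorem ofB_smul (S : ℂ⟦X⟧) (e : E) : S • e = ofB S • e := rfl

theorem toLocMod_smul (y : ATilde) (e : E) : toLocMod E (y • e) = toLoc y • toLocMod E e :=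
  (OreLocalization.smul_div_one (p := y) (r := e) (s := (1 : bPowers))).symm

/-- The canonical map `E → E[b⁻¹]` as a `ℂ⟦b⟧`-linear map. -/
noncomputable def toLocLin : E →ₗ[ℂ⟦X⟧] Loc E where
  toFun := toLocMod E
  map_add' e e' := (OreLocalization.add_oreDiv (r := e) (r' := e') (s := (1 : bPowers))).symm
  map_smul' S e := toLocMod_smul E (ofB S) e

theorem toLocLin_apply (e : E) : toLocLin E e = toLocMod E e := rfl

theorem X_pow_smul (n : ℕ) (v : Loc E) : (PowerSeries.X ^ n : ℂ⟦X⟧) • v = toLoc (b ^ n) • v := by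
  rw [powerSeries_smul_def, ofB_X_pow]

theorem exists_X_pow_smul_eq (v : Loc E) :
    ∃ (n : ℕ) (e : E), (PowerSeries.X ^ n : ℂ⟦X⟧) • v = toLocMod E e := by
  induction v using OreLocalization.ind with | _ e s =>
  obtain ⟨n, hn⟩ := (Submonoid.mem_powers_iff _ _).1 s.2
  refine ⟨n, e, ?_⟩
  have h := OreLocalization.smul_cancel (r := e) (s := s) (t := 1)
  rw [← hn] at h
  exact (X_pow_smul E n _).trans h

variable {E}

theorem eq_zero_of_X_pow_smul {n : ℕ} {v : Loc E} (h : (PowerSeries.X ^ n : ℂ⟦X⟧) • v = 0) :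
    v = 0 := by
  rw [X_pow_smul] at h
  rw [← one_smul ATildeLoc v, ← bInv_pow_mul_toLoc_b_pow n, mul_smul, h, smul_zero]

/-- An element dies in the localisation only if some $b^n$ kills it, and $b$ can be cancelled $n$
times. -/
theorem toLocLin_injective (hb : ∀ e : E, b • e = 0 → e = 0) : Function.Injective (toLocLin E) := by
  rw [injective_iff_map_eq_zero]
  intro e he
  have he' : OreLocalization.oreDiv e (1 : bPowers) = OreLocalization.oreDiv 0 1 :=
    (show OreLocalization.oreDiv e (1 : bPowers) = 0 from he).trans
      (OreLocalization.zero_oreDiv 1).symm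
  obtain ⟨u, v, h1, h2⟩ := OreLocalization.oreDiv_eq_iff.1 he'
  obtain ⟨n, hn⟩ := (Submonoid.mem_powers_iff _ _).1 u.2
  have h3 : v = b ^ n := by simpa [hn] using h2.symm
  rw [smul_zero, h3] at h1
  clear hn h2 h3
  induction n with
  | zero => simpa using h1.symm
  | succ n ih => exact ih (hb _ (by rw [← mul_smul, ← pow_succ', ← h1])).symm

/-- $b^{-1}a$ is not $\mathbb C[[b]]$-linear: it satisfies the Leibniz rule over the derivation
$b\partial_b$, because $[a,S]=b^2S'$. -/
theorem shift_smul (S : ℂ⟦X⟧) (v : Loc E) : (bInv * toLoc a) • S • v =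
    S • (bInv * toLoc a) • v + (PowerSeries.X * PowerSeries.derivative ℂ S) • v := by
  have h1 : toLoc (ofB S) * bInv = bInv * toLoc (ofB S) := by
    have h2 : toLoc b * toLoc (ofB S) = toLoc (ofB S) * toLoc b := by
      rw [← map_mul, ← map_mul, b, ← map_mul, ← map_mul, mul_comm]
    calc toLoc (ofB S) * bInv = bInv * (toLoc b * toLoc (ofB S)) * bInv := by
          rw [← mul_assoc, bInv_mul_b, one_mul]
      _ = bInv * toLoc (ofB S) := by
          rw [h2, mul_assoc, mul_assoc, b_mul_bInv, mul_one]
  have h3 : bInv * toLoc (ofB (PowerSeries.X ^ 2 * PowerSeries.derivative ℂ S)) =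
      toLoc (ofB (PowerSeries.X * PowerSeries.derivative ℂ S)) := by
    rw [pow_two, mul_assoc, map_mul ofB, map_mul toLoc, ← b, ← mul_assoc, bInv_mul_b, one_mul]
  simp only [powerSeries_smul_def, ← mul_smul, ← add_smul]
  rw [mul_assoc, ← map_mul, a_mul_ofB, map_add, mul_add, h3, map_mul, ← mul_assoc, ← h1, mul_assoc]

/-- By the Leibniz rule the defect of linearity stays in the span, so stability need only be tested
on generators. -/
theorem shift_mem_span {T : Set (Loc E)}
    (h : ∀ v ∈ T, (bInv * toLoc a) • v ∈ Submodule.span ℂ⟦X⟧ T) {v : Loc E}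
    (hv : v ∈ Submodule.span ℂ⟦X⟧ T) : (bInv * toLoc a) • v ∈ Submodule.span ℂ⟦X⟧ T := by
  induction hv using Submodule.span_induction with
  | mem v hv => exact h v hv
  | zero => rw [smul_zero]; exact Submodule.zero_mem _
  | add v w _ _ hv hw => rw [smul_add]; exact Submodule.add_mem _ hv hw
  | smul S v hv' hv =>
    rw [shift_smul]
    exact Submodule.add_mem _ (Submodule.smul_mem _ _ hv) (Submodule.smul_mem _ _ hv')

/-! ### The saturation -/

theorem saturation_le {F : Submodule ℂ⟦X⟧ (Loc E)} (h : ∀ e : E, toLocMod E e ∈ F)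
    (h' : ∀ v ∈ F, (bInv * toLoc a) • v ∈ F) : saturation E ≤ F :=
  sInf_le ⟨h, h'⟩

theorem toLocMod_mem_saturation (e : E) : toLocMod E e ∈ saturation E := by
  rw [saturation, Submodule.mem_sInf]
  exact fun F hF => hF.1 e

/-- The vector `b⁻ʲ aʲ e`. -/
noncomputable def frac (e : E) (j : ℕ) : Loc E := (bInv ^ j * toLoc (a ^ j)) • toLocMod E e

theorem frac_zero (e : E) : frac e 0 = toLocMod E e := by simp [frac]

theorem shift_frac (e : E) (j : ℕ) :
    (bInv * toLoc a) • frac e j = frac e (j + 1) - (j : ℂ⟦X⟧) • frac e j := by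
  rw [frac, frac, powerSeries_smul_def, map_natCast, map_natCast, ← mul_smul, ← mul_smul, ← sub_smul,
    bInv_mul_a_mul_bInv_pow_mul_a_pow]

theorem X_pow_smul_frac (e : E) (j : ℕ) :
    (PowerSeries.X ^ j : ℂ⟦X⟧) • frac e j = toLocMod E (a ^ j • e) := by
  rw [X_pow_smul, frac, ← mul_smul, ← mul_assoc, toLoc_b_pow_mul_bInv_pow, one_mul, toLocMod_smul]

theorem frac_mem {F : Submodule ℂ⟦X⟧ (Loc E)} {e : E} (h : toLocMod E e ∈ F)
    (h' : ∀ v ∈ F, (bInv * toLoc a) • v ∈ F) (j : ℕ) : frac e j ∈ F := by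
  induction j with
  | zero => rwa [frac_zero]
  | succ j ih =>
    have : frac e (j + 1) = (bInv * toLoc a) • frac e j + (j : ℂ⟦X⟧) • frac e j := by
      rw [shift_frac]; abel
    rw [this]
    exact F.add_mem (h' _ ih) (F.smul_mem _ ih)

theorem frac_mem_saturation (e : E) (j : ℕ) : frac e j ∈ saturation E :=
  frac_mem (toLocMod_mem_saturation e) (fun _ hv => smul_mem_saturation E hv) j

/-- The `ℂ⟦b⟧`-submodule generated by the `b⁻ʲ aʲ e` with `j < n`. -/
noncomputable def fracSpan (e : E) (n : ℕ) : Submodule ℂ⟦X⟧ (Loc E) :=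
  Submodule.span ℂ⟦X⟧ (Set.range fun j : Fin n => frac e j)

theorem frac_mem_fracSpan (e : E) {j n : ℕ} (h : j < n) : frac e j ∈ fracSpan e n :=
  Submodule.subset_span ⟨⟨j, h⟩, rfl⟩

theorem mem_fracSpan {e : E} {n : ℕ} {v : Loc E} :
    v ∈ fracSpan e n ↔ ∃ S : ℕ → ℂ⟦X⟧, v = ∑ j ∈ Finset.range n, S j • frac e j := by
  constructor
  · intro h
    obtain ⟨c, hc⟩ := (Submodule.mem_span_range_iff_exists_fun _).1 h
    refine ⟨fun j => if h : j < n then c ⟨j, h⟩ else 0, ?_⟩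
    rw [← hc, ← Fin.sum_univ_eq_sum_range
      (fun j => (if h : j < n then c ⟨j, h⟩ else 0) • frac e j) n]
    refine Finset.sum_congr rfl fun j _ => ?_
    simp
  · rintro ⟨S, rfl⟩
    exact Submodule.sum_mem _ fun j hj =>
      Submodule.smul_mem _ _ (frac_mem_fracSpan e (Finset.mem_range.1 hj))

theorem fracSpan_fg (e : E) (n : ℕ) : (fracSpan e n).FG :=
  Submodule.fg_span (Set.finite_range _)

theorem fracSpan_mono (e : E) : Monotone (fracSpan e) := by
  intro m n h
  refine Submodule.span_le.2 ?_
  rintro _ ⟨j, rfl⟩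
  exact frac_mem_fracSpan e (j.2.trans_le h)

theorem fracSpan_le_saturation (e : E) (n : ℕ) : fracSpan e n ≤ saturation E := by
  refine Submodule.span_le.2 ?_
  rintro _ ⟨j, rfl⟩
  exact frac_mem_saturation e j

/-- If `b⁻ⁿ aⁿ e` is a combination of the `b⁻ʲ aʲ e` with `j < n` modulo a submodule stable by
`b⁻¹a`, these vectors generate a stable submodule modulo the given one. -/
theorem shift_mem_fracSpan_sup {e : E} {n : ℕ} {N : Submodule ℂ⟦X⟧ (Loc E)}
    (hN : ∀ v ∈ N, (bInv * toLoc a) • v ∈ N) (h : frac e n ∈ fracSpan e n ⊔ N) :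
    ∀ v ∈ fracSpan e n ⊔ N, (bInv * toLoc a) • v ∈ fracSpan e n ⊔ N := by
  have e1 : fracSpan e n ⊔ N =
      Submodule.span ℂ⟦X⟧ ((Set.range fun j : Fin n => frac e j) ∪ (N : Set (Loc E))) := by
    rw [Submodule.span_union, Submodule.span_eq, fracSpan]
  intro v hv
  rw [e1] at hv ⊢
  refine shift_mem_span ?_ hv
  rw [← e1]
  rintro v (⟨j, rfl⟩ | hv)
  · change (bInv * toLoc a) • frac e j ∈ _
    rw [shift_frac]
    refine Submodule.sub_mem _ ?_ (Submodule.smul_mem _ _ (Submodule.mem_sup_left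
      (frac_mem_fracSpan e j.2)))
    rcases Nat.lt_or_ge (j + 1) n with h1 | h1
    · exact Submodule.mem_sup_left (frac_mem_fracSpan e h1)
    · have : (j : ℕ) + 1 = n := le_antisymm j.2 h1
      rwa [this]
  · exact Submodule.mem_sup_right (hN v hv)

/-- For $n>0$ the image of $e$ is the generator $f_0$; for $n=0$ the hypothesis is already the
claim. -/
theorem toLocMod_mem_sup {e : E} {n : ℕ} {N : Submodule ℂ⟦X⟧ (Loc E)}
    (h : frac e n ∈ fracSpan e n ⊔ N) : toLocMod E e ∈ fracSpan e n ⊔ N := by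
  rw [← frac_zero]
  rcases Nat.eq_zero_or_pos n with rfl | hn
  · exact h
  · exact Submodule.mem_sup_left (frac_mem_fracSpan e hn)

theorem toLocMod_sum_smul (e : E) (n : ℕ) (S : ℕ → ℂ⟦X⟧) :
    toLocMod E ((∑ j ∈ Finset.range n, ofB (S j) * a ^ j) • e) =
      ∑ j ∈ Finset.range n, (S j * PowerSeries.X ^ j) • frac e j := by
  rw [Finset.sum_smul, ← toLocLin_apply, map_sum]
  refine Finset.sum_congr rfl fun j _ => ?_
  rw [mul_smul, ← ofB_smul, map_smul, toLocLin_apply, mul_smul, X_pow_smul_frac]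

/-- The exponents $k-j$ are exactly those for which $b^{k-j}a^je=b^kf_j$, so one power $b^k$ factors
out and the coefficients left are the power series $V_j$. -/
theorem toLocMod_weighted_smul (e : E) (k : ℕ) (V : ℕ → ℂ⟦X⟧) :
    toLocMod E (weighted k V • e) = (PowerSeries.X ^ k : ℂ⟦X⟧) •
      (frac e k + ∑ j ∈ Finset.range k, V j • frac e j) := by
  rw [weighted, add_smul, ← toLocLin_apply, map_add, toLocLin_apply, toLocLin_apply,
    toLocMod_sum_smul, ← X_pow_smul_frac, smul_add, Finset.smul_sum]
  refine congrArg _ (Finset.sum_congr rfl fun j hj => ?_)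
  have := Finset.mem_range.1 hj
  rw [← mul_smul, mul_assoc, ← pow_add, Nat.sub_add_cancel this.le, mul_comm]

end Modules

end AB

namespace AB

open ATilde

/-! ### Cyclic modules whose annihilator is generated by `weighted k V` -/

section Modules

variable {E : Type*} [AddCommGroup E] [Module ATilde E]

attribute [local instance] abModule

theorem IsABModule.eq_zero_of_b_smul (h : IsABModule E) (v : E) (hv : b • v = 0) : v = 0 := by
  have := h.1
  have h1 : (PowerSeries.X : ℂ⟦X⟧) • v = 0 := hv
  exact (smul_eq_zero.1 h1).resolve_left PowerSeries.X_ne_zero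

theorem sum_range_smul_eq (e : E) (k : ℕ) (S : ℕ → ℂ⟦X⟧) :
    (∑ j ∈ Finset.range k, ofB (S j) * a ^ j) • e = ∑ j : Fin k, S j • (a ^ (j : ℕ) • e) := by
  rw [Finset.sum_smul, Fin.sum_univ_eq_sum_range (fun j => S j • (a ^ j • e)) k]
  exact Finset.sum_congr rfl fun j _ => mul_smul _ _ _

/-- `e` generates `E`, with annihilator the left ideal generated by `x`. -/
structure IsCyclicGenerator (e : E) (x : ATilde) : Prop where
  surjective : ∀ v : E, ∃ y : ATilde, y • e = v
  annihilator : ∀ y : ATilde, y • e = 0 ↔ ∃ q : ATilde, q * x = y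

namespace IsCyclicGenerator

variable {e : E} {k : ℕ} {V : ℕ → ℂ⟦X⟧}

/-- A left multiple of `weighted k V` of degree less than $k$ in $a$ vanishes, by uniqueness of
division. -/
theorem eq_zero (h : IsCyclicGenerator e (weighted k V)) {S : ℕ → ℂ⟦X⟧}
    (hS : (∑ j ∈ Finset.range k, ofB (S j) * a ^ j) • e = 0) : ∀ j < k, S j = 0 := by
  obtain ⟨q, hq⟩ := (h.annihilator _).1 hS
  refine (eq_zero_of_mul_add_eq_zero (residue_weighted k V) (q := -q) ?_).2
  rw [← hq, neg_mul, neg_add_cancel]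

theorem exists_eq_sum (h : IsCyclicGenerator e (weighted k V)) (v : E) :
    ∃ S : ℕ → ℂ⟦X⟧, v = (∑ j ∈ Finset.range k, ofB (S j) * a ^ j) • e := by
  obtain ⟨y, rfl⟩ := h.surjective v
  obtain ⟨q, S, hy⟩ := exists_eq_mul_add (residue_weighted k V) y
  refine ⟨S, ?_⟩
  nth_rewrite 1 [hy]
  rw [add_smul, (h.annihilator _).2 ⟨q, rfl⟩, zero_add]

/-- The basis `e, ae, …, aᵏ⁻¹e` of `E` over `ℂ⟦b⟧`. -/
noncomputable def basis (h : IsCyclicGenerator e (weighted k V)) : Module.Basis (Fin k) ℂ⟦X⟧ E :=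
  Module.Basis.mk (v := fun j : Fin k => a ^ (j : ℕ) • e)
    (by
      rw [Fintype.linearIndependent_iff]
      intro c hc j
      have h1 := h.eq_zero (S := fun i => if hi : i < k then c ⟨i, hi⟩ else 0) (by
        rw [sum_range_smul_eq]
        simpa using hc) j j.2
      simpa using h1)
    (by
      intro v _
      obtain ⟨S, rfl⟩ := h.exists_eq_sum v
      rw [sum_range_smul_eq]
      exact Submodule.sum_mem _ fun j _ =>
        Submodule.smul_mem _ _ (Submodule.subset_span ⟨j, rfl⟩))

theorem isABModule (h : IsCyclicGenerator e (weighted k V)) : IsABModule E :=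
  ⟨Module.Free.of_basis h.basis, Module.Finite.of_basis h.basis⟩

theorem abRank_eq (h : IsCyclicGenerator e (weighted k V)) : abRank E = k :=
  (Module.finrank_eq_card_basis h.basis).trans (Fintype.card_fin k)

theorem frac_add_sum_eq_zero (h : IsCyclicGenerator e (weighted k V)) :
    frac e k + ∑ j ∈ Finset.range k, V j • frac e j = 0 := by
  refine eq_zero_of_X_pow_smul (n := k) ?_
  rw [← toLocMod_weighted_smul, (h.annihilator _).2 ⟨1, one_mul _⟩, ← toLocLin_apply, map_zero]

theorem frac_mem_fracSpan (h : IsCyclicGenerator e (weighted k V)) :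
    frac e k ∈ fracSpan e k := by
  rw [eq_neg_of_add_eq_zero_left h.frac_add_sum_eq_zero]
  exact Submodule.neg_mem _ (mem_fracSpan.2 ⟨V, rfl⟩)

/-- The span contains $E$ because $a^je=b^jf_j$, and it is stable because the relation brings $f_k$
back into it. -/
theorem saturation_eq (h : IsCyclicGenerator e (weighted k V)) : saturation E = fracSpan e k := by
  refine le_antisymm (saturation_le (fun v => ?_) ?_) (fracSpan_le_saturation e k)
  · obtain ⟨S, rfl⟩ := h.exists_eq_sum v
    rw [toLocMod_sum_smul]
    exact mem_fracSpan.2 ⟨_, rfl⟩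
  · have := shift_mem_fracSpan_sup (e := e) (n := k) (N := ⊥) (by simp)
      (by rw [sup_bot_eq]; exact h.frac_mem_fracSpan)
    rwa [sup_bot_eq] at this

theorem isRegular (h : IsCyclicGenerator e (weighted k V)) : IsRegular E :=
  ⟨h.isABModule, by rw [h.saturation_eq]; exact fracSpan_fg e k⟩

/-- Multiplying by $b^k$ turns the relation into one among the basis vectors $a^je$ of $E$, with
coefficients $S_jb^{k-j}$. -/
theorem eq_zero_of_sum_frac (h : IsCyclicGenerator e (weighted k V)) {S : ℕ → ℂ⟦X⟧}
    (hS : ∑ j ∈ Finset.range k, S j • frac e j = 0) : ∀ j < k, S j = 0 := by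
  intro j hj
  have h1 := h.eq_zero (S := fun j => S j * PowerSeries.X ^ (k - j)) (by
    refine toLocLin_injective h.isABModule.eq_zero_of_b_smul ?_
    rw [toLocLin_apply, toLocMod_sum_smul, map_zero, ← smul_zero (PowerSeries.X ^ k : ℂ⟦X⟧), ← hS,
      Finset.smul_sum]
    refine Finset.sum_congr rfl fun j hj => ?_
    rw [mul_assoc, ← pow_add, Nat.sub_add_cancel (Finset.mem_range.1 hj).le, mul_comm, mul_smul]) j hj
  exact (mul_eq_zero.1 h1).resolve_right (pow_ne_zero _ PowerSeries.X_ne_zero)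

end IsCyclicGenerator

/-! ### The quotient `E♯ / b E♯` -/

/-- The class of `b⁻ʲ aʲ e` in `E♯ / b E♯`. -/
noncomputable def fracClass (e : E) (j : ℕ) : SatQuot E :=
  Submodule.Quotient.mk ⟨frac e j, frac_mem_saturation e j⟩

theorem satQuotNeg_fracClass (e : E) (j : ℕ) :
    satQuotNeg E (fracClass e j) = (j : ℂ) • fracClass e j - fracClass e (j + 1) := by
  change Submodule.Quotient.mk (satNeg E _) = Submodule.Quotient.mk ((j : ℂ) • _ - _)
  congr 1
  refine Subtype.ext ?_
  change (-(bInv * toLoc a)) • frac e j = (j : ℂ) • frac e j - frac e (j + 1)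
  rw [neg_smul, shift_frac, neg_sub, complex_smul_def, powerSeries_smul_def, map_natCast, map_natCast,
    map_natCast]

/-- Same recursion as in $\tilde{\mathcal A}[b^{-1}]$; it exhibits every class as a polynomial in
$b^{-1}a$ applied to the class of $e$. -/
theorem aeval_ascPochhammer_fracClass (e : E) (j : ℕ) :
    Polynomial.aeval (-satQuotNeg E) (ascPochhammer ℂ j) (fracClass e 0) = fracClass e j := by
  induction j with
  | zero => simp
  | succ j ih =>
    rw [ascPochhammer_succ_right, mul_comm, map_mul, Module.End.mul_apply, ih, map_add,
      Polynomial.aeval_X, map_natCast, LinearMap.add_apply, LinearMap.neg_apply,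
      satQuotNeg_fracClass, Module.End.natCast_apply, Nat.cast_smul_eq_nsmul]
    abel

/-- $S_j-S_j(0)$ is a multiple of $b$, so its contribution lies in $bE^\sharp$. -/
theorem mk_sum_frac (e : E) (k : ℕ) (S : ℕ → ℂ⟦X⟧)
    (h : ∑ j ∈ Finset.range k, S j • frac e j ∈ satC E) :
    (Submodule.Quotient.mk ⟨_, h⟩ : SatQuot E) =
      ∑ j ∈ Finset.range k, PowerSeries.constantCoeff (S j) • fracClass e j := by
  have hW : ∀ j, ∃ W : ℂ⟦X⟧, S j - PowerSeries.C (PowerSeries.constantCoeff (S j)) =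
      PowerSeries.X * W := fun j => PowerSeries.X_dvd_iff.2 (by simp)
  choose W hW using hW
  have h2 : ∑ j ∈ Finset.range k, PowerSeries.constantCoeff (S j) • fracClass e j =
      Submodule.Quotient.mk (∑ j ∈ Finset.range k, PowerSeries.constantCoeff (S j) •
        (⟨frac e j, frac_mem_saturation e j⟩ : satC E)) := by
    rw [← Submodule.mkQ_apply, map_sum]
    rfl
  rw [h2, Submodule.Quotient.eq]
  refine ⟨⟨∑ j ∈ Finset.range k, W j • frac e j,
    fracSpan_le_saturation e k (mem_fracSpan.2 ⟨W, rfl⟩)⟩, Subtype.ext ?_⟩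
  change (PowerSeries.X : ℂ⟦X⟧) • ∑ j ∈ Finset.range k, W j • frac e j = _
  rw [Submodule.coe_sub, Submodule.coe_sum, Finset.smul_sum, ← Finset.sum_sub_distrib]
  refine Finset.sum_congr rfl fun j _ => ?_
  rw [← mul_smul, ← hW, sub_smul]
  rfl

namespace IsCyclicGenerator

variable {e : E} {k : ℕ} {V : ℕ → ℂ⟦X⟧}

/-- The basis of `E♯ / b E♯` formed by the classes of the `b⁻ʲ aʲ e`, `j < k`. -/
noncomputable def quotBasis (h : IsCyclicGenerator e (weighted k V)) :
    Module.Basis (Fin k) ℂ (SatQuot E) :=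
  Module.Basis.mk (v := fun j : Fin k => fracClass e j)
    (by
      rw [Fintype.linearIndependent_iff]
      intro c hc j
      set d : ℕ → ℂ := fun i => if hi : i < k then c ⟨i, hi⟩ else 0 with hd
      have hm : ∑ i ∈ Finset.range k, (PowerSeries.C (d i) : ℂ⟦X⟧) • frac e i ∈ satC E :=
        fracSpan_le_saturation e k (mem_fracSpan.2 ⟨_, rfl⟩)
      have h1 : (Submodule.Quotient.mk ⟨_, hm⟩ : SatQuot E) = 0 := by
        rw [mk_sum_frac, ← hc]
        simp_rw [PowerSeries.constantCoeff_C]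
        rw [← Fin.sum_univ_eq_sum_range (fun i => d i • fracClass e i) k]
        simp [hd]
      rw [Submodule.Quotient.mk_eq_zero] at h1
      -- A relation modulo $bE^\sharp$ reads $\sum d_if_i=bw$ with $w=\sum S_if_i$; independence
      -- over $\mathbb C[[b]]$ gives $d_i=bS_i$, hence $d_i=0$.
      obtain ⟨w, hw⟩ := h1
      have hw2 : (w : Loc E) ∈ fracSpan e k := by
        rw [← h.saturation_eq]; exact w.2
      obtain ⟨S, hS⟩ := mem_fracSpan.1 hw2
      have hw3 : (PowerSeries.X : ℂ⟦X⟧) • (w : Loc E) =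
          ∑ i ∈ Finset.range k, (PowerSeries.C (d i) : ℂ⟦X⟧) • frac e i := congrArg Subtype.val hw
      have h2 := h.eq_zero_of_sum_frac (S := fun i => PowerSeries.C (d i) - PowerSeries.X * S i) (by
        simp_rw [sub_smul, Finset.sum_sub_distrib, mul_smul]
        rw [← Finset.smul_sum, ← hS, hw3, sub_self]) j j.2
      have h3 := congrArg PowerSeries.constantCoeff h2
      simpa [hd] using h3)
    (by
      intro q _
      obtain ⟨⟨v, hv⟩, rfl⟩ := Submodule.Quotient.mk_surjective _ q
      have hv2 : v ∈ fracSpan e k := by rw [← h.saturation_eq]; exact hv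
      obtain ⟨S, rfl⟩ := mem_fracSpan.1 hv2
      rw [mk_sum_frac]
      exact Submodule.sum_mem _ fun j hj =>
        Submodule.smul_mem _ _ (Submodule.subset_span ⟨⟨j, Finset.mem_range.1 hj⟩, rfl⟩))

/-- The class of $e$ is a cyclic vector; the rising factorials are composed with $-x$ because the
operator is $-b^{-1}a$. -/
theorem exists_eq_aeval (h : IsCyclicGenerator e (weighted k V)) (q : SatQuot E) :
    ∃ f : ℂ[X], Polynomial.aeval (satQuotNeg E) f (fracClass e 0) = q := by
  refine ⟨∑ j : Fin k, Polynomial.C (h.quotBasis.repr q j) *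
    (ascPochhammer ℂ j).comp (-Polynomial.X), ?_⟩
  nth_rewrite 2 [← h.quotBasis.sum_repr q]
  rw [map_sum, LinearMap.sum_apply]
  refine Finset.sum_congr rfl fun j _ => ?_
  rw [map_mul, Polynomial.aeval_C, Polynomial.aeval_comp, map_neg, Polynomial.aeval_X,
    Module.End.mul_apply, aeval_ascPochhammer_fracClass, Module.algebraMap_end_apply, quotBasis,
    Module.Basis.mk_apply]

end IsCyclicGenerator

/-! ### The polynomial of the homogeneous part, and the Bernstein polynomial -/

/-- The polynomial `p` with `bᵏ p(b⁻¹a) = weightedLead k V`. -/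
noncomputable def leadPoly (k : ℕ) (V : ℕ → ℂ⟦X⟧) : ℂ[X] :=
  ascPochhammer ℂ k + ∑ j ∈ Finset.range k,
    Polynomial.C (PowerSeries.constantCoeff (V j)) * ascPochhammer ℂ j

theorem toLoc_weightedLead (k : ℕ) (V : ℕ → ℂ⟦X⟧) : toLoc (weightedLead k V) =
    toLoc (b ^ k) * Polynomial.aeval (bInv * toLoc a) (leadPoly k V) := by
  rw [weightedLead, leadPoly, map_add, map_add, mul_add, map_sum, map_sum, Finset.mul_sum]
  have h1 := toLoc_b_pow_mul_a_pow (le_refl k)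
  rw [Nat.sub_self, pow_zero, one_mul] at h1
  rw [h1]
  refine congrArg _ (Finset.sum_congr rfl fun j hj => ?_)
  rw [map_mul, Polynomial.aeval_C, ← mul_assoc, ← Algebra.commutes, mul_assoc,
    ← toLoc_b_pow_mul_a_pow (Finset.mem_range.1 hj).le, Algebra.smul_def, map_mul]
  rfl

theorem leadPoly_degree (k : ℕ) (V : ℕ → ℂ⟦X⟧) :
    (leadPoly k V).Monic ∧ (leadPoly k V).natDegree = k := by
  have hk : (ascPochhammer ℂ k).degree = k := by
    rw [Polynomial.degree_eq_natDegree (monic_ascPochhammer ℂ k).ne_zero, ascPochhammer_natDegree]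
  have hlt : (∑ j ∈ Finset.range k, Polynomial.C (PowerSeries.constantCoeff (V j)) *
      ascPochhammer ℂ j).degree < (ascPochhammer ℂ k).degree := by
    rw [hk]
    refine (Polynomial.degree_sum_le _ _).trans_lt
      ((Finset.sup_lt_iff (WithBot.bot_lt_coe k)).2 fun j hj => ?_)
    refine (Polynomial.C_mul' (PowerSeries.constantCoeff (V j)) (ascPochhammer ℂ j) ▸
      Polynomial.degree_smul_le _ _).trans_lt ?_
    rw [Polynomial.degree_eq_natDegree (monic_ascPochhammer ℂ j).ne_zero, ascPochhammer_natDegree]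
    exact WithBot.coe_lt_coe.2 (Finset.mem_range.1 hj)
  refine ⟨(monic_ascPochhammer ℂ k).add_of_left hlt, ?_⟩
  rw [leadPoly, Polynomial.natDegree_add_eq_left_of_degree_lt hlt, ascPochhammer_natDegree]

/-- The polynomial `(-1)ᵏ p(-x)`, with `p` as in `leadPoly`. -/
noncomputable def reflPoly (k : ℕ) (V : ℕ → ℂ⟦X⟧) : ℂ[X] :=
  Polynomial.C ((-1) ^ k) * (leadPoly k V).comp (-Polynomial.X)

theorem reflPoly_degree (k : ℕ) (V : ℕ → ℂ⟦X⟧) :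
    (reflPoly k V).Monic ∧ (reflPoly k V).natDegree = k := by
  obtain ⟨h1, h2⟩ := leadPoly_degree k V
  have hne : ((-1 : ℂ) ^ k) ≠ 0 := pow_ne_zero _ (by norm_num)
  constructor
  · rw [Polynomial.Monic, reflPoly, Polynomial.leadingCoeff_mul, Polynomial.leadingCoeff_C,
      Polynomial.leadingCoeff_comp (by simp), h1.leadingCoeff, h2, Polynomial.leadingCoeff_neg,
      Polynomial.leadingCoeff_X, one_mul, ← mul_pow]
    simp
  · rw [reflPoly, Polynomial.natDegree_C_mul hne, Polynomial.natDegree_comp, h2]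
    simp

theorem aeval_reflPoly {A : Type*} [Ring A] [Algebra ℂ A] (k : ℕ) (V : ℕ → ℂ⟦X⟧) (t : A) :
    Polynomial.aeval t (reflPoly k V) = (-1) ^ k * Polynomial.aeval (-t) (leadPoly k V) := by
  rw [reflPoly, map_mul, Polynomial.aeval_C, Polynomial.aeval_comp, map_neg, Polynomial.aeval_X]
  simp

/-- The sign $(-1)^k$ that keeps `reflPoly` monic cancels the sign of $(-b)^k$. -/
theorem neg_b_pow_mul_aeval_reflPoly (k : ℕ) (V : ℕ → ℂ⟦X⟧) :
    (-toLoc b) ^ k * Polynomial.aeval (-(bInv * toLoc a)) (reflPoly k V) =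
      toLoc (weightedLead k V) := by
  rw [aeval_reflPoly, neg_neg, toLoc_weightedLead, neg_pow (toLoc b) k, ← mul_assoc, map_pow]
  congr 1
  rw [((Commute.neg_one_left (toLoc b)).pow_pow k k).eq, mul_assoc, ← pow_add, ← two_mul, pow_mul,
    neg_one_sq, one_pow, mul_one]

namespace IsCyclicGenerator

variable {e : E} {k : ℕ} {V : ℕ → ℂ⟦X⟧}

/-- This is the relation $f_k+\sum V_jf_j=0$ read modulo $b$, where $V_j$ becomes $V_j(0)$. -/
theorem aeval_leadPoly_eq_zero (h : IsCyclicGenerator e (weighted k V)) :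
    Polynomial.aeval (-satQuotNeg E) (leadPoly k V) (fracClass e 0) = 0 := by
  have h0 : frac e k = ∑ j ∈ Finset.range k, (-V j) • frac e j := by
    rw [eq_neg_of_add_eq_zero_left h.frac_add_sum_eq_zero, ← Finset.sum_neg_distrib]
    simp_rw [neg_smul]
  have h1 : fracClass e k =
      ∑ j ∈ Finset.range k, PowerSeries.constantCoeff (-V j) • fracClass e j := by
    rw [← mk_sum_frac e k (fun j => -V j) (by rw [← h0]; exact frac_mem_saturation e k), fracClass]
    simp_rw [h0]
  rw [leadPoly, map_add, LinearMap.add_apply, aeval_ascPochhammer_fracClass, map_sum,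
    LinearMap.sum_apply, h1, ← Finset.sum_add_distrib]
  refine Finset.sum_eq_zero fun j _ => ?_
  rw [map_mul, Polynomial.aeval_C, Module.End.mul_apply, aeval_ascPochhammer_fracClass,
    Module.algebraMap_end_apply, ← add_smul, map_neg, neg_add_cancel, zero_smul]

/-- A polynomial in the operator that kills a cyclic vector kills the whole space. -/
theorem aeval_reflPoly_eq_zero (h : IsCyclicGenerator e (weighted k V)) :
    Polynomial.aeval (satQuotNeg E) (reflPoly k V) = 0 := by
  refine LinearMap.ext fun q => ?_
  obtain ⟨f, rfl⟩ := h.exists_eq_aeval q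
  rw [← Module.End.mul_apply, ← map_mul, mul_comm, map_mul, Module.End.mul_apply, aeval_reflPoly,
    Module.End.mul_apply, h.aeval_leadPoly_eq_zero, map_zero, map_zero, LinearMap.zero_apply]

theorem finite_satQuot (h : IsCyclicGenerator e (weighted k V)) : Module.Finite ℂ (SatQuot E) :=
  Module.Finite.of_basis h.quotBasis

theorem finrank_satQuot (h : IsCyclicGenerator e (weighted k V)) :
    Module.finrank ℂ (SatQuot E) = k :=
  (Module.finrank_eq_card_basis h.quotBasis).trans (Fintype.card_fin k)

/-- Applied to the cyclic vector, the remainders modulo the minimal polynomial already fill the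
space, whose dimension is $k$. -/
theorem le_natDegree_minpoly (h : IsCyclicGenerator e (weighted k V)) :
    k ≤ (minpoly ℂ (satQuotNeg E)).natDegree := by
  have := h.finite_satQuot
  set m := minpoly ℂ (satQuotNeg E) with hm
  have hmon : m.Monic := minpoly.monic (Algebra.IsIntegral.isIntegral _)
  let φ : Polynomial.degreeLT ℂ m.natDegree →ₗ[ℂ] SatQuot E :=
    (LinearMap.applyₗ (fracClass e 0)).comp
      ((Polynomial.aeval (satQuotNeg E)).toLinearMap.comp (Submodule.subtype _))
  have hφ : Function.Surjective φ := by
    intro q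
    obtain ⟨f, rfl⟩ := h.exists_eq_aeval q
    refine ⟨⟨f %ₘ m, Polynomial.mem_degreeLT.2 ?_⟩, ?_⟩
    · rw [← Polynomial.degree_eq_natDegree hmon.ne_zero]
      exact Polynomial.degree_modByMonic_lt _ hmon
    · change Polynomial.aeval (satQuotNeg E) (f %ₘ m) (fracClass e 0) = _
      rw [Polynomial.aeval_modByMonic_eq_self_of_root (minpoly.aeval _ _)]
  have hfin : Module.Finite ℂ (Polynomial.degreeLT ℂ m.natDegree) :=
    Module.Finite.equiv (Polynomial.degreeLTEquiv ℂ m.natDegree).symm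
  have h1 := LinearMap.finrank_le_finrank_of_surjective hφ
  rwa [h.finrank_satQuot, (Polynomial.degreeLTEquiv ℂ m.natDegree).finrank_eq,
    Module.finrank_fin_fun] at h1

theorem minpoly_eq (h : IsCyclicGenerator e (weighted k V)) :
    minpoly ℂ (satQuotNeg E) = reflPoly k V := by
  have := h.finite_satQuot
  obtain ⟨h1, h2⟩ := reflPoly_degree k V
  exact (Polynomial.eq_of_monic_of_dvd_of_natDegree_le
    (minpoly.monic (Algebra.IsIntegral.isIntegral _)) h1 (minpoly.dvd _ _ h.aeval_reflPoly_eq_zero)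
    (h2.trans_le h.le_natDegree_minpoly)).symm

/-- The characteristic polynomial is a monic multiple of the minimal one, of degree $k$, which the
minimal one already attains. -/
theorem bernstein_eq (h : IsCyclicGenerator e (weighted k V)) : bernstein E = reflPoly k V := by
  have hf := h.finite_satQuot
  rw [bernstein, dif_pos hf, ← h.minpoly_eq]
  refine Polynomial.eq_of_monic_of_dvd_of_natDegree_le
    (minpoly.monic (Algebra.IsIntegral.isIntegral _)) (LinearMap.charpoly_monic _)
    (LinearMap.minpoly_dvd_charpoly _) ?_
  rw [LinearMap.charpoly_natDegree, h.finrank_satQuot]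
  exact h.le_natDegree_minpoly

end IsCyclicGenerator

end Modules

end AB

namespace AB

open ATilde

section Modules

variable {E : Type*} [AddCommGroup E] [Module ATilde E]

attribute [local instance] abModule

/-! ### Regular modules with a generator -/

/-- $b^{-1}a(bw)=b(b^{-1}a\,w+w)$. -/
theorem shift_mem_X_smul_saturation {v : Loc E}
    (hv : v ∈ Ideal.span {(PowerSeries.X : ℂ⟦X⟧)} • saturation E) :
    (bInv * toLoc a) • v ∈ Ideal.span {(PowerSeries.X : ℂ⟦X⟧)} • saturation E := by
  rw [Submodule.ideal_span_singleton_smul] at hv ⊢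
  obtain ⟨w, hw, rfl⟩ := (Submodule.mem_smul_pointwise_iff_exists _ _ _).1 hv
  rw [shift_smul, PowerSeries.derivative_X, mul_one, ← smul_add]
  exact Submodule.smul_mem_pointwise_smul _ _ _ (add_mem (smul_mem_saturation E hw) hw)

/-- If `b⁻ⁿ aⁿ e` is a combination of the `b⁻ʲ aʲ e` with `j < n` modulo `b E♯`, these vectors
generate `E♯`. -/
theorem fracSpan_eq_saturation (hfg : (saturation E).FG) {e : E}
    (he : ∀ v : E, ∃ y : ATilde, y • e = v) {n : ℕ}
    (h : frac e n ∈ fracSpan e n ⊔ Ideal.span {(PowerSeries.X : ℂ⟦X⟧)} • saturation E) :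
    fracSpan e n = saturation E := by
  refine le_antisymm (fracSpan_le_saturation e n) ?_
  have hst := shift_mem_fracSpan_sup (fun v hv => shift_mem_X_smul_saturation hv) h
  -- Nakayama: `fracSpan e n` plus $bE^\sharp$ is stable under $b^{-1}a$, so it contains $E^\sharp$
  -- once it contains $E$.
  refine Submodule.le_of_le_smul_of_le_jacobson_bot hfg
    (I := Ideal.span {(PowerSeries.X : ℂ⟦X⟧)}) ?_ (saturation_le (fun v => ?_) hst)
  · rw [IsLocalRing.jacobson_eq_maximalIdeal _ bot_ne_top]
    refine IsLocalRing.le_maximalIdeal ?_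
    rw [Ne, Ideal.span_singleton_eq_top]
    exact PowerSeries.X_prime.not_isUnit
  · obtain ⟨y, rfl⟩ := he v
    -- Write $y=Y(a)+bz$: the part $bze$ lies in $bE^\sharp$, and $Y(a)e$ is a combination of
    -- vectors $f_j$, all of which, even for $j\ge n$, lie in the stable submodule.
    obtain ⟨z, hz⟩ : b ∣ y - ofA (residue y) := by
      rw [b_dvd_iff, residue_sub, residue_ofA, sub_self]
    have hA : ofA (residue y) = ∑ j ∈ Finset.range ((residue y).natDegree + 1),
        ofB (PowerSeries.C ((residue y).coeff j)) * a ^ j := by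
      refine ext_coef fun m j => ?_
      rw [coef_sum_ofB_mul_a_pow, coef, ofA, PowerSeries.coeff_C, PowerSeries.coeff_C]
      have hj : j ∉ Finset.range ((residue y).natDegree + 1) → (residue y).coeff j = 0 := fun hj =>
        Polynomial.coeff_eq_zero_of_natDegree_lt (by simpa using hj)
      split_ifs <;> simp_all
    have hy : y = ofA (residue y) + b * z := by rw [← hz]; abel
    rw [hy, add_smul, ← toLocLin_apply, map_add, toLocLin_apply, toLocLin_apply, hA,
      toLocMod_sum_smul]
    refine Submodule.add_mem _ (Submodule.sum_mem _ fun j _ => Submodule.smul_mem _ _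
      (frac_mem (toLocMod_mem_sup h) hst j)) (Submodule.mem_sup_right ?_)
    rw [mul_smul, toLocMod_smul, Submodule.ideal_span_singleton_smul]
    exact Submodule.smul_mem_pointwise_smul (toLocMod E (z • e)) (PowerSeries.X : ℂ⟦X⟧) _
      (toLocMod_mem_saturation _)

/-- $E^\sharp$ is noetherian over $\mathbb C[[b]]$, so the increasing chain of the spans becomes
stationary. -/
theorem exists_frac_mem_fracSpan (hfg : (saturation E).FG) (e : E) :
    ∃ n, frac e n ∈ fracSpan e n := by
  have hN : IsNoetherian ℂ⟦X⟧ (saturation E) := isNoetherian_of_fg_of_noetherian _ hfg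
  obtain ⟨n, hn⟩ := monotone_stabilizes_iff_noetherian.2 hN
    ⟨fun n => (fracSpan e n).comap (saturation E).subtype,
      fun m n h => Submodule.comap_mono (fracSpan_mono e h)⟩
  refine ⟨n, ?_⟩
  have h1 := hn (n + 1) (Nat.le_succ n)
  have h2 : (⟨frac e n, frac_mem_saturation e n⟩ : saturation E) ∈
      (fracSpan e (n + 1)).comap (saturation E).subtype :=
    frac_mem_fracSpan e (Nat.lt_succ_self n)
  exact (SetLike.ext_iff.1 h1 _).2 h2

/-- Vectors none of which is a combination of the previous ones modulo `b E♯` are linearly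
independent over `ℂ⟦b⟧`. -/
theorem eq_zero_of_sum_smul_frac {e : E} {n : ℕ}
    (h : ∀ m < n, frac e m ∉ fracSpan e m ⊔ Ideal.span {(PowerSeries.X : ℂ⟦X⟧)} • saturation E)
    {S : ℕ → ℂ⟦X⟧} (hS : ∑ j ∈ Finset.range n, S j • frac e j = 0) : ∀ j < n, S j = 0 := by
  have step : ∀ S : ℕ → ℂ⟦X⟧, ∑ j ∈ Finset.range n, S j • frac e j = 0 →
      ∀ j < n, PowerSeries.X ∣ S j := by
    intro S hS
    by_contra! hcon
    classical
    -- For the largest $m$ with $b\nmid S_m$, the later terms lie in $bE^\sharp$ and $S_m$ is a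
    -- unit, so $f_m$ is a combination of the earlier ones modulo $bE^\sharp$.
    let T := (Finset.range n).filter fun j => ¬ PowerSeries.X ∣ S j
    have hT : T.Nonempty := by
      obtain ⟨j, hj, hj'⟩ := hcon
      exact ⟨j, Finset.mem_filter.2 ⟨Finset.mem_range.2 hj, hj'⟩⟩
    obtain ⟨hm1, hm2⟩ := Finset.mem_filter.1 (T.max'_mem hT)
    set m := T.max' hT with hm
    have hmn := Finset.mem_range.1 hm1
    refine h m hmn ?_
    have hu : IsUnit (S m) := by
      rw [PowerSeries.isUnit_iff_constantCoeff, isUnit_iff_ne_zero]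
      exact fun h0 => hm2 (PowerSeries.X_dvd_iff.2 h0)
    obtain ⟨u, hu⟩ := hu
    have key : S m • frac e m ∈
        fracSpan e m ⊔ Ideal.span {(PowerSeries.X : ℂ⟦X⟧)} • saturation E := by
      rw [← Finset.add_sum_erase _ _ hm1] at hS
      rw [eq_neg_of_add_eq_zero_left hS]
      refine Submodule.neg_mem _ (Submodule.sum_mem _ fun j hj => ?_)
      obtain ⟨hjm, hj⟩ := Finset.mem_erase.1 hj
      rcases lt_or_gt_of_ne hjm with hlt | hgt
      · exact Submodule.mem_sup_left (Submodule.smul_mem _ _ (frac_mem_fracSpan e hlt))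
      · refine Submodule.mem_sup_right (Submodule.smul_mem_smul ?_ (frac_mem_saturation e j))
        rw [Ideal.mem_span_singleton]
        by_contra hnd
        exact absurd (T.le_max' j (Finset.mem_filter.2 ⟨hj, hnd⟩)) (not_le.2 hgt)
    have := Submodule.smul_mem _ (↑u⁻¹ : ℂ⟦X⟧) key
    rwa [← hu, ← mul_smul, Units.inv_mul, one_smul] at this
  -- $E[b^{-1}]$ has no $b$-torsion, so the relation can be divided by $b$ and the argument
  -- repeated: each $S_j$ is divisible by every power of $b$.
  have all : ∀ N : ℕ, ∀ S : ℕ → ℂ⟦X⟧, ∑ j ∈ Finset.range n, S j • frac e j = 0 →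
      ∀ j < n, PowerSeries.X ^ N ∣ S j := by
    intro N
    induction N with
    | zero => intro S _ j _; simp
    | succ N ih =>
      intro S hS j hj
      have hT : ∀ j, ∃ T : ℂ⟦X⟧, j < n → S j = PowerSeries.X * T := by
        intro j
        by_cases hj : j < n
        · obtain ⟨T, hT⟩ := step S hS j hj
          exact ⟨T, fun _ => hT⟩
        · exact ⟨0, fun h => absurd h hj⟩
      choose T hT using hT
      rw [hT j hj, pow_succ']
      refine mul_dvd_mul_left _ (ih T (eq_zero_of_X_pow_smul (n := 1) ?_) j hj)
      rw [pow_one, ← hS, Finset.smul_sum]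
      refine Finset.sum_congr rfl fun i hi => ?_
      rw [hT i (Finset.mem_range.1 hi), mul_smul]
  intro j hj
  ext m
  exact PowerSeries.X_pow_dvd_iff.1 (all (m + 1) S hS j hj) m (Nat.lt_succ_self m)

/-- A regular (a,b)-module and its saturation have the same rank. -/
theorem finrank_saturation (h : IsRegular E) :
    Module.finrank ℂ⟦X⟧ (saturation E) = abRank E := by
  obtain ⟨hE, hfg⟩ := h
  have hinj := toLocLin_injective hE.eq_zero_of_b_smul
  have hEfin : Module.Finite ℂ⟦X⟧ E := hE.2
  have hfin : Module.Finite ℂ⟦X⟧ (saturation E) := Module.Finite.iff_fg.2 hfg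
  refine le_antisymm ?_ ?_
  · obtain ⟨T, hT⟩ := hfg
    -- A common denominator for the finitely many generators; multiplication by $b^N$ then embeds
    -- $E^\sharp$ in the image of $E$.
    have hN : ∃ N : ℕ, ∀ v ∈ T, (PowerSeries.X ^ N : ℂ⟦X⟧) • v ∈ LinearMap.range (toLocLin E) := by
      have := fun v : Loc E => exists_X_pow_smul_eq E v
      choose n f hf using this
      refine ⟨T.sup n, fun v hv => ?_⟩
      obtain ⟨d, hd⟩ := Nat.exists_eq_add_of_le' (Finset.le_sup (f := n) hv)
      rw [hd, pow_add, mul_smul, hf]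
      exact Submodule.smul_mem _ _ ⟨f v, rfl⟩
    obtain ⟨N, hN⟩ := hN
    have hle : ∀ v ∈ saturation E, (PowerSeries.X ^ N : ℂ⟦X⟧) • v ∈ LinearMap.range (toLocLin E) := by
      have : saturation E ≤ (LinearMap.range (toLocLin E)).comap
          (LinearMap.lsmul ℂ⟦X⟧ (Loc E) (PowerSeries.X ^ N)) := by
        rw [← hT]
        exact Submodule.span_le.2 hN
      exact this
    let φ : saturation E →ₗ[ℂ⟦X⟧] LinearMap.range (toLocLin E) :=
      ((LinearMap.lsmul ℂ⟦X⟧ (Loc E) (PowerSeries.X ^ N)).comp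
        (saturation E).subtype).codRestrict _ fun v => hle v v.2
    have hφ : Function.Injective φ := by
      rw [injective_iff_map_eq_zero]
      intro v hv
      exact Subtype.ext (eq_zero_of_X_pow_smul (n := N) (congrArg Subtype.val hv))
    refine (LinearMap.finrank_le_finrank_of_injective hφ).trans_eq ?_
    exact LinearMap.finrank_range_of_inj hinj
  · let ψ : E →ₗ[ℂ⟦X⟧] saturation E :=
      (toLocLin E).codRestrict _ fun v => toLocMod_mem_saturation v
    have hψ : Function.Injective ψ := fun v w hvw => hinj (congrArg Subtype.val hvw)
    exact LinearMap.finrank_le_finrank_of_injective hψ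

/-- The annihilator of a generator of a regular (a,b)-module of rank `k` is generated by an
element of the form `a ^ k + ∑ⱼ Vⱼ(b) b ^ (k - j) a ^ j`. -/
theorem IsRegular.exists_isCyclicGenerator (h : IsRegular E) {e : E}
    (he : ∀ v : E, ∃ y : ATilde, y • e = v) :
    ∃ V : ℕ → ℂ⟦X⟧, IsCyclicGenerator e (weighted (abRank E) V) := by
  classical
  have hex : ∃ n, frac e n ∈
      fracSpan e n ⊔ Ideal.span {(PowerSeries.X : ℂ⟦X⟧)} • saturation E := by
    obtain ⟨n, hn⟩ := exists_frac_mem_fracSpan h.2 e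
    exact ⟨n, Submodule.mem_sup_left hn⟩
  -- Minimality modulo $bE^\sharp$ serves twice: the relation at $n$ gives generation by Nakayama,
  -- and its absence below $n$ gives independence.
  set n := Nat.find hex with hn
  have hind : ∀ S : ℕ → ℂ⟦X⟧, ∑ j ∈ Finset.range n, S j • frac e j = 0 → ∀ j < n, S j = 0 :=
    fun S hS => eq_zero_of_sum_smul_frac (fun m hm => Nat.find_min hex hm) hS
  have hspan : fracSpan e n = saturation E := fracSpan_eq_saturation h.2 he (Nat.find_spec hex)
  have hrank : abRank E = n := by
    have hli : LinearIndependent ℂ⟦X⟧ fun j : Fin n => frac e j := by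
      rw [Fintype.linearIndependent_iff]
      intro c hc j
      have h1 := hind (fun i => if hi : i < n then c ⟨i, hi⟩ else 0) (by
        rw [← Fin.sum_univ_eq_sum_range
          (fun i => (if hi : i < n then c ⟨i, hi⟩ else 0) • frac e i) n]
        simpa using hc) j j.2
      simpa using h1
    have h1 := finrank_span_eq_card hli
    rw [Fintype.card_fin] at h1
    rw [← finrank_saturation h, ← hspan]
    exact h1
  have hmem : frac e n ∈ fracSpan e n := by rw [hspan]; exact frac_mem_saturation e n
  obtain ⟨S, hS⟩ := mem_fracSpan.1 hmem
  have hinj := toLocLin_injective h.1.eq_zero_of_b_smul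
  rw [hrank]
  have hx : weighted n (fun j => -S j) • e = 0 := by
    refine hinj ?_
    rw [toLocLin_apply, toLocMod_weighted_smul, map_zero, hS]
    simp_rw [neg_smul]
    rw [Finset.sum_neg_distrib, add_neg_cancel, smul_zero]
  refine ⟨fun j => -S j, he, fun y => ⟨fun hy => ?_, ?_⟩⟩
  · obtain ⟨q, U, hqU⟩ := exists_eq_mul_add (residue_weighted n fun j => -S j) y
    refine ⟨q, ?_⟩
    rw [hqU, add_smul, mul_smul, hx, smul_zero, zero_add] at hy
    have h1 := congrArg (toLocMod E) hy
    rw [toLocMod_sum_smul, ← toLocLin_apply, map_zero] at h1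
    have h2 := hind _ h1
    rw [hqU, Finset.sum_eq_zero fun j hj => ?_, add_zero]
    rw [(mul_eq_zero.1 (h2 j (Finset.mem_range.1 hj))).resolve_right
      (pow_ne_zero _ PowerSeries.X_ne_zero), map_zero, zero_mul]
  · rintro ⟨q, rfl⟩
    rw [mul_smul, hx, smul_zero]

end Modules

/-! ### Quotients of `Ã` -/

theorem isCyclicGenerator_mk_one_iff {I : Submodule ATilde ATilde} {x : ATilde} :
    IsCyclicGenerator (Submodule.Quotient.mk 1 : ATilde ⧸ I) x ↔ I = Submodule.span ATilde {x} := by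
  have h1 : ∀ y : ATilde, y • (Submodule.Quotient.mk 1 : ATilde ⧸ I) = Submodule.Quotient.mk y := by
    intro y
    rw [← Submodule.Quotient.mk_smul, smul_eq_mul, mul_one]
  constructor
  · intro h
    ext y
    rw [← Submodule.Quotient.mk_eq_zero, ← h1, h.annihilator, Submodule.mem_span_singleton]
    rfl
  · rintro rfl
    refine ⟨fun v => ?_, fun y => ?_⟩
    · obtain ⟨y, rfl⟩ := Submodule.Quotient.mk_surjective _ v
      exact ⟨y, h1 y⟩
    · rw [h1, Submodule.Quotient.mk_eq_zero, Submodule.mem_span_singleton]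
      rfl

theorem IsCyclicGenerator.map {E E' : Type*} [AddCommGroup E] [Module ATilde E] [AddCommGroup E']
    [Module ATilde E'] {e : E} {x : ATilde} (h : IsCyclicGenerator e x) (φ : E ≃ₗ[ATilde] E') :
    IsCyclicGenerator (φ e) x where
  surjective v := by
    obtain ⟨y, hy⟩ := h.surjective (φ.symm v)
    exact ⟨y, by rw [← map_smul, hy, φ.apply_symm_apply]⟩
  annihilator y := by rw [← map_smul, φ.map_eq_zero_iff, h.annihilator]

/-- The leading parts of two elements that annihilate generators of the same module agree. -/
theorem IsCyclicGenerator.weightedLead_eq {E : Type*} [AddCommGroup E] [Module ATilde E] {e e' : E}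
    {k k' : ℕ} {V V' : ℕ → ℂ⟦X⟧} (h : IsCyclicGenerator e (weighted k V))
    (h' : IsCyclicGenerator e' (weighted k' V')) : weightedLead k V = weightedLead k' V' := by
  obtain rfl : k = k' := h.abRank_eq.symm.trans h'.abRank_eq
  refine toLoc_injective ?_
  -- Both sides are $(-b)^kB_E(-b^{-1}a)$, with $k$ the rank of the same module $E$.
  rw [← neg_b_pow_mul_aeval_reflPoly, ← neg_b_pow_mul_aeval_reflPoly, ← h.bernstein_eq,
    ← h'.bernstein_eq]

end AB

theorem mainTheorem1 (I : Submodule AB.ATilde AB.ATilde) (k : ℕ) :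
    -- the quotient is a regular (a,b)-module of rank `k` iff `I` has a generator in standard form
    ((AB.IsRegular (AB.ATilde ⧸ I) ∧ AB.abRank (AB.ATilde ⧸ I) = k) ↔
      ∃ P R : AB.ATilde, AB.IsStandardPair k P R ∧
        I = Submodule.span AB.ATilde {P + AB.ATilde.b ^ 2 * R}) ∧
    -- uniqueness of the standard form
    (∀ P R P' R' : AB.ATilde, AB.IsStandardPair k P R → AB.IsStandardPair k P' R' →
      I = Submodule.span AB.ATilde {P + AB.ATilde.b ^ 2 * R} →
      I = Submodule.span AB.ATilde {P' + AB.ATilde.b ^ 2 * R'} → P = P' ∧ R = R') ∧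
    (∀ P R : AB.ATilde, AB.IsStandardPair k P R →
      I = Submodule.span AB.ATilde {P + AB.ATilde.b ^ 2 * R} →
      -- the Bernstein polynomial is also the minimal polynomial, and it gives `P`
      AB.bernstein (AB.ATilde ⧸ I) = minpoly ℂ (AB.satQuotNeg (AB.ATilde ⧸ I)) ∧
      (-AB.toLoc AB.ATilde.b) ^ k *
          Polynomial.aeval (-(AB.bInv * AB.toLoc AB.ATilde.a)) (AB.bernstein (AB.ATilde ⧸ I)) =
        AB.toLoc P ∧
      -- `P` only depends on the isomorphism class of the quotient
      ∀ (I' : Submodule AB.ATilde AB.ATilde) (k' : ℕ) (P' R' : AB.ATilde),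
        AB.IsStandardPair k' P' R' →
        I' = Submodule.span AB.ATilde {P' + AB.ATilde.b ^ 2 * R'} →
        Nonempty ((AB.ATilde ⧸ I) ≃ₗ[AB.ATilde] (AB.ATilde ⧸ I')) → P = P') := by
  refine ⟨⟨?_, ?_⟩, ?_, ?_⟩
  · rintro ⟨hreg, hk⟩
    obtain ⟨V, hV⟩ := hreg.exists_isCyclicGenerator (e := Submodule.Quotient.mk 1) fun v => by
      obtain ⟨y, rfl⟩ := Submodule.Quotient.mk_surjective _ v
      exact ⟨y, by rw [← Submodule.Quotient.mk_smul, smul_eq_mul, mul_one]⟩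
    rw [hk] at hV
    obtain ⟨P, R, hPR, hx⟩ := AB.exists_isStandardPair k V
    exact ⟨P, R, hPR, by rw [hx]; exact AB.isCyclicGenerator_mk_one_iff.1 hV⟩
  · rintro ⟨P, R, hPR, hI⟩
    obtain ⟨V, -, hx⟩ := hPR.exists_weighted
    rw [hx] at hI
    have h := AB.isCyclicGenerator_mk_one_iff.2 hI
    exact ⟨h.isRegular, h.abRank_eq⟩
  · intro P R P' R' h h' hI hI'
    obtain ⟨V, -, hx⟩ := h.exists_weighted
    obtain ⟨V', -, hx'⟩ := h'.exists_weighted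
    refine h.eq_of_add_eq h' ?_
    rw [hx] at hI ⊢
    rw [hx'] at hI' ⊢
    exact AB.weighted_eq_of_span_eq (hI.symm.trans hI')
  · intro P R hPR hI
    obtain ⟨V, hP, hx⟩ := hPR.exists_weighted
    rw [hx] at hI
    have h := AB.isCyclicGenerator_mk_one_iff.2 hI
    refine ⟨by rw [h.bernstein_eq, h.minpoly_eq], ?_, ?_⟩
    · rw [h.bernstein_eq, AB.neg_b_pow_mul_aeval_reflPoly, hP]
    · rintro I' k' P' R' hPR' hI' ⟨φ⟩
      obtain ⟨V', hP', hx'⟩ := hPR'.exists_weighted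
      rw [hx'] at hI'
      rw [hP, hP']
      -- Carrying the generator along the isomorphism puts both generators in one module, so
      -- invariance of $B_E$ under isomorphism need not be proved separately.
      exact (h.map φ).weightedLead_eq (AB.isCyclicGenerator_mk_one_iff.2 hI')
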